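/- A \emph{unital commutative distributive $\ell$-monoid} is an algebra $\langle M; +, \lor, \land, 0, 1, -1\rangle$ such that $\langle M;\lor,\land\rangle$ is a distributive lattice, $\langle M; +, 0\rangle$ is a commutative monoid, $+$ distributes over $\lor$ and $\land$, $-1+1=0$, $-1\le 0\le 1$, and for every $x \in M$ there is an integer $n \geq 1$ with $n(-1)\le x\le n1$ (where $nx$ denotes the $n$-fold sum $x + \dots + x$). Let $\mathsf{ULM}$ be the category of these algebras and their homomorphisms (maps preserving $+,\lor,\land,0,1,-1$). An \emph{MV-monoidal algebra} is an algebra $\langle A;\oplus,\odot,\lor,\land,0,1\rangle$ satisfying the following finitely many equational axioms: $\langle A;\lor,\land\rangle$ is a distributive lattice; $\langle A;\oplus,0\rangle$ and $\langle A;\odot,1\rangle$ are commutative monoids; $\oplus$ and $\odot$ both distribute over both $\lor$ and $\land$; and $$(x\oplus y)\odot((x\odot y)\oplus z)=(x\odot(y\oplus z))\oplus(y\odot z),$$ $$(x\odot y)\oplus((x\oplus y)\odot z)=(x\oplus(y\odot z))\odot(y\oplus z),$$ $$(x\odot y)\oplus z=((x\oplus y)\odot((x\odot y)\oplus z))\lor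 z,$$ $$(x\oplus y)\odot z=((x\odot y)\oplus((x\oplus y)\odot z))\land z.$$ Let $\mathsf{MVM}$ be the category of these algebras and their homomorphisms (maps preserving $\oplus,\odot,\lor,\land,0,1$). For $M\in\mathsf{ULM}$ let $\Gamma(M)=\{x\in M\mid 0\le x\le 1\}$, with $\lor,\land,0,1$ restricted from $M$, $x\oplus y=(x+y)\land 1$ and $x\odot y=(x+y+(-1))\lor 0$; this is an MV-monoidal algebra. For a homomorphism $f$ let $\Gamma(f)$ be its restriction. This defines a functor $\Gamma\colon\mathsf{ULM}\to\mathsf{MVM}$. For $A\in\mathsf{MVM}$, a \emph{good $\mathbb{Z}$-sequence} in $A$ is a function $\mathbf{x}\colon\mathbb{Z}\to A$ such that $\mathbf{x}(k)=1$ for all sufficiently small $k$, $\mathbf{x}(k)=0$ for all sufficiently large $k$, and $\mathbf{x}(k)\oplus\mathbf{x}(k+1)=\mathbf{x}(k)$ and $\mathbf{x}(k)\odot\mathbf{x}(k+1)=\mathbf{x}(k+1)$ for all $k\in\mathbb{Z}$. Let $\Xi(A)$ be the set of good $\mathbb{Z}$-sequences in $A$, with componentwise $\lor$ and $\land$, with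 $$(\mathbf{a}+\mathbf{b})(n)=\bigodot_{k\in\mathbb{Z}}\bigl(\mathbf{a}(k)\oplus\mathbf{b}(n-k)\bigr)$$ (all but finitely many terms equal $1$), and with each constant $m\in\{0,1,-1\}$ interpreted as the sequence that is $1$ at $n<m$ and $0$ at $n\ge m$. For a homomorphism $f\colon A\to B$ of MV-monoidal algebras let $\Xi(f)(\mathbf{x})(n)=f(\mathbf{x}(n))$. \textbf{Theorem.} For every MV-monoidal algebra $A$, the set $\Xi(A)$ is closed under these operations and is a unital commutative distributive $\ell$-monoid, so that $\Xi$ is a functor $\mathsf{MVM}\to\mathsf{ULM}$. The categories $\mathsf{ULM}$ and $\mathsf{MVM}$ are equivalent, as witnessed by the quasi-inverse functors $\Gamma\colon\mathsf{ULM}\to\mathsf{MVM}$ and $\Xi\colon\mathsf{MVM}\to\mathsf{ULM}$. -/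

import Mathlib

open CategoryTheory

universe u

namespace MVMonoidal

/-! ### Unital commutative distributive lattice-ordered monoids -/

/-- Algebras in the signature `+, ∨, ∧, 0, 1, -1` (of arities `2, 2, 2, 0, 0, 0`). -/
class ULMOps (M : Type u) extends Add M, Max M, Min M, Zero M, One M where
  /-- the constant `-1` -/
  negOne : M

/-- The axioms of unital commutative distributive lattice-ordered monoids. The order is that of the
lattice: `x ≤ y` means `x ⊔ y = y`. The element `nsmulRec n x` is the `n`-fold sum `x + ⋯ + x`. -/
class IsULM (M : Type u) [ULMOps M] : Prop where
  sup_comm (x y : M) : x ⊔ y = y ⊔ x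
  inf_comm (x y : M) : x ⊓ y = y ⊓ x
  sup_assoc (x y z : M) : (x ⊔ y) ⊔ z = x ⊔ (y ⊔ z)
  inf_assoc (x y z : M) : (x ⊓ y) ⊓ z = x ⊓ (y ⊓ z)
  sup_inf_self (x y : M) : x ⊔ (x ⊓ y) = x
  inf_sup_self (x y : M) : x ⊓ (x ⊔ y) = x
  inf_sup_left (x y z : M) : x ⊓ (y ⊔ z) = (x ⊓ y) ⊔ (x ⊓ z)
  add_assoc (x y z : M) : (x + y) + z = x + (y + z)
  add_comm (x y : M) : x + y = y + x
  zero_add (x : M) : 0 + x = x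
  add_zero (x : M) : x + 0 = x
  sup_add (x y z : M) : (x ⊔ y) + z = (x + z) ⊔ (y + z)
  add_sup (x y z : M) : x + (y ⊔ z) = (x + y) ⊔ (x + z)
  inf_add (x y z : M) : (x ⊓ y) + z = (x + z) ⊓ (y + z)
  add_inf (x y z : M) : x + (y ⊓ z) = (x + y) ⊓ (x + z)
  negOne_add_one : (ULMOps.negOne + 1 : M) = 0
  one_add_negOne : (1 + ULMOps.negOne : M) = 0
  negOne_le_zero : (ULMOps.negOne ⊔ 0 : M) = 0
  zero_le_one : (0 ⊔ 1 : M) = 1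
  exists_bound (x : M) : ∃ n : ℕ, 0 < n ∧
    nsmulRec n (ULMOps.negOne : M) ⊔ x = x ∧ x ⊔ nsmulRec n (1 : M) = nsmulRec n (1 : M)

/-- Homomorphisms of algebras in the signature `+, ∨, ∧, 0, 1, -1`. -/
@[ext]
structure ULMHom (M N : Type u) [ULMOps M] [ULMOps N] where
  toFun : M → N
  map_add (x y : M) : toFun (x + y) = toFun x + toFun y
  map_sup (x y : M) : toFun (x ⊔ y) = toFun x ⊔ toFun y
  map_inf (x y : M) : toFun (x ⊓ y) = toFun x ⊓ toFun y
  map_zero : toFun 0 = 0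
  map_one : toFun 1 = 1
  map_negOne : toFun ULMOps.negOne = ULMOps.negOne

/-- Unital commutative distributive lattice-ordered monoids. -/
structure ULM : Type (u + 1) where
  carrier : Type u
  [ops : ULMOps carrier]
  [isULM : IsULM carrier]

attribute [instance] ULM.ops ULM.isULM

instance : CoeSort ULM.{u} (Type u) := ⟨ULM.carrier⟩

/-- The category of unital commutative distributive lattice-ordered monoids and homomorphisms. -/
instance : Category ULM.{u} where
  Hom M N := ULMHom M N
  id M := ⟨fun x => x, fun _ _ => rfl, fun _ _ => rfl, fun _ _ => rfl, rfl, rfl, rfl⟩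
  comp f g := ⟨fun x => g.toFun (f.toFun x),
    fun x y => by rw [f.map_add, g.map_add], fun x y => by rw [f.map_sup, g.map_sup],
    fun x y => by rw [f.map_inf, g.map_inf], by rw [f.map_zero, g.map_zero],
    by rw [f.map_one, g.map_one], by rw [f.map_negOne, g.map_negOne]⟩

/-! ### MV-monoidal algebras -/

/-- Algebras in the signature `⊕, ⊙, ∨, ∧, 0, 1` (of arities `2, 2, 2, 2, 0, 0`). -/
class MVMOps (A : Type u) extends Max A, Min A, Zero A, One A where
  /-- the operation `⊕` -/
  oplus : A → A → A
  /-- the operation `⊙` -/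
  odot : A → A → A

infixl:65 " ⊕ₘ " => MVMOps.oplus
infixl:65 " ⊙ₘ " => MVMOps.odot

/-- The (finitely many, equational) axioms of MV-monoidal algebras. -/
class IsMVM (A : Type u) [MVMOps A] : Prop where
  sup_comm (x y : A) : x ⊔ y = y ⊔ x
  inf_comm (x y : A) : x ⊓ y = y ⊓ x
  sup_assoc (x y z : A) : (x ⊔ y) ⊔ z = x ⊔ (y ⊔ z)
  inf_assoc (x y z : A) : (x ⊓ y) ⊓ z = x ⊓ (y ⊓ z)
  sup_inf_self (x y : A) : x ⊔ (x ⊓ y) = x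
  inf_sup_self (x y : A) : x ⊓ (x ⊔ y) = x
  inf_sup_left (x y z : A) : x ⊓ (y ⊔ z) = (x ⊓ y) ⊔ (x ⊓ z)
  oplus_assoc (x y z : A) : (x ⊕ₘ y) ⊕ₘ z = x ⊕ₘ (y ⊕ₘ z)
  oplus_comm (x y : A) : x ⊕ₘ y = y ⊕ₘ x
  oplus_zero (x : A) : x ⊕ₘ 0 = x
  odot_assoc (x y z : A) : (x ⊙ₘ y) ⊙ₘ z = x ⊙ₘ (y ⊙ₘ z)
  odot_comm (x y : A) : x ⊙ₘ y = y ⊙ₘ x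
  odot_one (x : A) : x ⊙ₘ 1 = x
  oplus_sup (x y z : A) : x ⊕ₘ (y ⊔ z) = (x ⊕ₘ y) ⊔ (x ⊕ₘ z)
  oplus_inf (x y z : A) : x ⊕ₘ (y ⊓ z) = (x ⊕ₘ y) ⊓ (x ⊕ₘ z)
  odot_sup (x y z : A) : x ⊙ₘ (y ⊔ z) = (x ⊙ₘ y) ⊔ (x ⊙ₘ z)
  odot_inf (x y z : A) : x ⊙ₘ (y ⊓ z) = (x ⊙ₘ y) ⊓ (x ⊙ₘ z)
  ax4 (x y z : A) : (x ⊕ₘ y) ⊙ₘ ((x ⊙ₘ y) ⊕ₘ z) = (x ⊙ₘ (y ⊕ₘ z)) ⊕ₘ (y ⊙ₘ z)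
  ax5 (x y z : A) : (x ⊙ₘ y) ⊕ₘ ((x ⊕ₘ y) ⊙ₘ z) = (x ⊕ₘ (y ⊙ₘ z)) ⊙ₘ (y ⊕ₘ z)
  ax6 (x y z : A) : (x ⊙ₘ y) ⊕ₘ z = ((x ⊕ₘ y) ⊙ₘ ((x ⊙ₘ y) ⊕ₘ z)) ⊔ z
  ax7 (x y z : A) : (x ⊕ₘ y) ⊙ₘ z = ((x ⊙ₘ y) ⊕ₘ ((x ⊕ₘ y) ⊙ₘ z)) ⊓ z

/-- Homomorphisms of algebras in the signature `⊕, ⊙, ∨, ∧, 0, 1`. -/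
@[ext]
structure MVMHom (A B : Type u) [MVMOps A] [MVMOps B] where
  toFun : A → B
  map_oplus (x y : A) : toFun (x ⊕ₘ y) = toFun x ⊕ₘ toFun y
  map_odot (x y : A) : toFun (x ⊙ₘ y) = toFun x ⊙ₘ toFun y
  map_sup (x y : A) : toFun (x ⊔ y) = toFun x ⊔ toFun y
  map_inf (x y : A) : toFun (x ⊓ y) = toFun x ⊓ toFun y
  map_zero : toFun 0 = 0
  map_one : toFun 1 = 1

/-- MV-monoidal algebras. -/
structure MVM : Type (u + 1) where
  carrier : Type u
  [ops : MVMOps carrier]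
  [isMVM : IsMVM carrier]

attribute [instance] MVM.ops MVM.isMVM

instance : CoeSort MVM.{u} (Type u) := ⟨MVM.carrier⟩

/-- The category of MV-monoidal algebras and homomorphisms. -/
instance : Category MVM.{u} where
  Hom A B := MVMHom A B
  id A := ⟨fun x => x, fun _ _ => rfl, fun _ _ => rfl, fun _ _ => rfl, fun _ _ => rfl, rfl, rfl⟩
  comp f g := ⟨fun x => g.toFun (f.toFun x),
    fun x y => by rw [f.map_oplus, g.map_oplus], fun x y => by rw [f.map_odot, g.map_odot],
    fun x y => by rw [f.map_sup, g.map_sup], fun x y => by rw [f.map_inf, g.map_inf],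
    by rw [f.map_zero, g.map_zero], by rw [f.map_one, g.map_one]⟩

/-! ### The unit interval functor -/

section UnitInterval

variable {M : Type u} [ULMOps M] [IsULM M]

/-- The distributive lattice underlying a unital commutative distributive ℓ-monoid. -/
instance ulmLattice : DistribLattice M :=
  { Lattice.mk' IsULM.sup_comm IsULM.sup_assoc IsULM.inf_comm IsULM.inf_assoc
      IsULM.sup_inf_self IsULM.inf_sup_self with
    le_sup_inf := by
      let _ : Lattice M := Lattice.mk' IsULM.sup_comm IsULM.sup_assoc IsULM.inf_comm
        IsULM.inf_assoc IsULM.sup_inf_self IsULM.inf_sup_self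
      exact (DistribLattice.ofInfSupLe (α := M)
        (fun a b c => (IsULM.inf_sup_left a b c).le)).le_sup_inf }

/-- The commutative monoid underlying a unital commutative distributive ℓ-monoid. -/
instance ulmMonoid : AddCommMonoid M where
  add_assoc := IsULM.add_assoc
  zero_add := IsULM.zero_add
  add_zero := IsULM.add_zero
  add_comm := IsULM.add_comm
  nsmul := nsmulRec

instance : IsOrderedAddMonoid M where
  add_le_add_left a b h c := by
    rw [← sup_eq_right] at h ⊢
    rw [← IsULM.sup_add, h]

theorem ulm_zero_le_one : (0 : M) ≤ 1 := sup_eq_right.1 IsULM.zero_le_one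

variable (M) in
/-- The unit interval `{x | 0 ≤ x ≤ 1}`. -/
@[ext]
structure UnitInterval : Type u where
  val : M
  zero_le : 0 ≤ val
  le_one : val ≤ 1

theorem one_cancel (a : M) : a + 1 + ULMOps.negOne = a := by
  rw [add_assoc, IsULM.one_add_negOne, add_zero]

theorem add_negOne_le {a b : M} (h : b ≤ 1) : a + b + ULMOps.negOne ≤ a :=
  (add_le_add_left (add_le_add_right h a) _).trans_eq (one_cancel a)

/-- The operations `x ⊕ y = (x + y) ∧ 1`, `x ⊙ y = (x + y - 1) ∨ 0`, and the restrictions of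
`∨, ∧, 0, 1` to the unit interval. -/
instance : MVMOps (UnitInterval M) where
  oplus x y := ⟨(x.val + y.val) ⊓ 1, le_inf (add_nonneg x.zero_le y.zero_le) ulm_zero_le_one, inf_le_right⟩
  odot x y := ⟨(x.val + y.val + ULMOps.negOne) ⊔ 0, le_sup_right,
    sup_le ((add_negOne_le y.le_one).trans x.le_one) ulm_zero_le_one⟩
  max x y := ⟨x.val ⊔ y.val, x.zero_le.trans le_sup_left, sup_le x.le_one y.le_one⟩
  min x y := ⟨x.val ⊓ y.val, le_inf x.zero_le y.zero_le, inf_le_left.trans x.le_one⟩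
  zero := ⟨0, le_rfl, ulm_zero_le_one⟩
  one := ⟨1, ulm_zero_le_one, le_rfl⟩

namespace UnitInterval

theorem val_oplus (x y : UnitInterval M) : (x ⊕ₘ y).val = (x.val + y.val) ⊓ 1 := rfl
theorem val_odot (x y : UnitInterval M) :
    (x ⊙ₘ y).val = (x.val + y.val + ULMOps.negOne) ⊔ 0 := rfl
theorem val_sup (x y : UnitInterval M) : (x ⊔ y).val = x.val ⊔ y.val := rfl
theorem val_inf (x y : UnitInterval M) : (x ⊓ y).val = x.val ⊓ y.val := rfl
theorem val_zero : (0 : UnitInterval M).val = 0 := rfl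
theorem val_one : (1 : UnitInterval M).val = 1 := rfl

theorem oplus_add_odot (x y : UnitInterval M) : (x ⊕ₘ y).val + (x ⊙ₘ y).val = x.val + y.val := by
  have h : ((x.val + y.val) ⊓ 1) + ((x.val + y.val) ⊔ 1) = x.val + y.val + 1 := by
    apply le_antisymm
    · rw [IsULM.add_sup]
      exact sup_le ((add_le_add_left inf_le_right _).trans_eq (add_comm _ _))
        (add_le_add_left inf_le_left _)
    · rw [IsULM.inf_add]
      exact le_inf (add_le_add_right le_sup_right _)
        ((add_comm _ _).trans_le (add_le_add_right le_sup_left _))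
  have h2 : (x ⊙ₘ y).val = ((x.val + y.val) ⊔ 1) + ULMOps.negOne := by
    rw [val_odot, IsULM.sup_add, IsULM.one_add_negOne]
  rw [h2, val_oplus, ← add_assoc, h, one_cancel]

theorem odot_oplus (x y z : UnitInterval M) :
    ((x ⊙ₘ y) ⊕ₘ z).val = ((x.val + y.val + z.val + ULMOps.negOne) ⊔ z.val) ⊓ 1 := by
  rw [val_oplus, val_odot, IsULM.sup_add, zero_add, add_right_comm]

theorem oplus_odot (x y z : UnitInterval M) :
    ((x ⊕ₘ y) ⊙ₘ z).val = ((x.val + y.val + z.val + ULMOps.negOne) ⊓ z.val) ⊔ 0 := by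
  rw [val_odot, val_oplus, IsULM.inf_add, IsULM.inf_add, add_comm 1 z.val, one_cancel]

theorem oplus_comm' (x y : UnitInterval M) : x ⊕ₘ y = y ⊕ₘ x :=
  UnitInterval.ext (by rw [val_oplus, val_oplus, add_comm])

theorem odot_comm' (x y : UnitInterval M) : x ⊙ₘ y = y ⊙ₘ x :=
  UnitInterval.ext (by rw [val_odot, val_odot, add_comm x.val])

theorem sigma_one (x y z : UnitInterval M) :
    ((x ⊕ₘ y) ⊙ₘ ((x ⊙ₘ y) ⊕ₘ z)).val = ((x.val + y.val + z.val + ULMOps.negOne) ⊔ 0) ⊓ 1 := by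
  rw [odot_comm', oplus_odot, add_right_comm (x ⊙ₘ y).val, add_comm (x ⊙ₘ y).val, oplus_add_odot,
    val_oplus, ← inf_assoc, inf_eq_left.2 (add_negOne_le z.le_one), sup_inf_right,
    sup_eq_left.2 ulm_zero_le_one]

theorem sigma_two (x y z : UnitInterval M) :
    ((x ⊙ₘ y) ⊕ₘ ((x ⊕ₘ y) ⊙ₘ z)).val = ((x.val + y.val + z.val + ULMOps.negOne) ⊔ 0) ⊓ 1 := by
  have h : x.val + y.val + ULMOps.negOne ≤ x.val + y.val + z.val + ULMOps.negOne :=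
    add_le_add_left (le_add_of_nonneg_right z.zero_le) _
  rw [oplus_comm', odot_oplus, add_right_comm (x ⊕ₘ y).val, oplus_add_odot,
    val_odot, ← sup_assoc, sup_eq_left.2 h]

theorem sigma_three (x y z : UnitInterval M) :
    ((x ⊙ₘ (y ⊕ₘ z)) ⊕ₘ (y ⊙ₘ z)).val = ((x.val + y.val + z.val + ULMOps.negOne) ⊔ 0) ⊓ 1 := by
  rw [oplus_comm', odot_comm' x, sigma_two, add_comm (y.val + z.val), ← add_assoc]

theorem sigma_four (x y z : UnitInterval M) :
    ((x ⊕ₘ (y ⊙ₘ z)) ⊙ₘ (y ⊕ₘ z)).val = ((x.val + y.val + z.val + ULMOps.negOne) ⊔ 0) ⊓ 1 := by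
  rw [odot_comm', oplus_comm' x, sigma_one, add_comm (y.val + z.val), ← add_assoc]

end UnitInterval

open UnitInterval in
/-- The unit interval is an MV-monoidal algebra. -/
instance : IsMVM (UnitInterval M) where
  sup_comm _ _ := UnitInterval.ext (sup_comm _ _)
  inf_comm _ _ := UnitInterval.ext (inf_comm _ _)
  sup_assoc _ _ _ := UnitInterval.ext (sup_assoc _ _ _)
  inf_assoc _ _ _ := UnitInterval.ext (inf_assoc _ _ _)
  sup_inf_self _ _ := UnitInterval.ext sup_inf_self
  inf_sup_self _ _ := UnitInterval.ext inf_sup_self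
  inf_sup_left _ _ _ := UnitInterval.ext (inf_sup_left _ _ _)
  oplus_assoc x y z := UnitInterval.ext <| by
    have h (a b c : UnitInterval M) : ((a ⊕ₘ b) ⊕ₘ c).val = (a.val + b.val + c.val) ⊓ 1 := by
      rw [val_oplus, val_oplus, IsULM.inf_add, inf_assoc,
        inf_eq_right.2 (le_add_of_nonneg_right c.zero_le)]
    rw [h, oplus_comm' x, h, add_comm (y.val + z.val), ← add_assoc]
  oplus_comm := oplus_comm'
  oplus_zero x := UnitInterval.ext <| by rw [val_oplus, val_zero, add_zero, inf_eq_left.2 x.le_one]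
  odot_assoc x y z := UnitInterval.ext <| by
    have h (a b c : UnitInterval M) : ((a ⊙ₘ b) ⊙ₘ c).val =
        (a.val + b.val + c.val + ULMOps.negOne + ULMOps.negOne) ⊔ 0 := by
      have h0 : 0 + c.val + ULMOps.negOne ≤ 0 := add_negOne_le c.le_one
      rw [val_odot, val_odot, IsULM.sup_add, IsULM.sup_add, sup_assoc, sup_eq_right.2 h0,
        add_right_comm (a.val + b.val)]
    rw [h, odot_comm' x, h, add_comm (y.val + z.val), ← add_assoc]
  odot_comm := odot_comm'
  odot_one x := UnitInterval.ext <| by rw [val_odot, val_one, one_cancel, sup_eq_left.2 x.zero_le]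
  oplus_sup x y z := UnitInterval.ext <| by
    simp only [val_oplus, val_sup, IsULM.add_sup, inf_sup_right]
  oplus_inf x y z := UnitInterval.ext <| by
    simp only [val_oplus, val_inf, IsULM.add_inf]
    exact inf_inf_distrib_right _ _ _
  odot_sup x y z := UnitInterval.ext <| by
    simp only [val_odot, val_sup, IsULM.add_sup, IsULM.sup_add]
    exact sup_sup_distrib_right _ _ _
  odot_inf x y z := UnitInterval.ext <| by
    simp only [val_odot, val_inf, IsULM.add_inf, IsULM.inf_add, sup_inf_right]
  ax4 x y z := UnitInterval.ext <| by rw [sigma_one, sigma_three]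
  ax5 x y z := UnitInterval.ext <| by rw [sigma_two, sigma_four]
  ax6 x y z := UnitInterval.ext <| by
    rw [val_sup, sigma_one, odot_oplus, sup_inf_right, sup_assoc, sup_eq_right.2 z.zero_le,
      sup_eq_left.2 z.le_one]
  ax7 x y z := UnitInterval.ext <| by
    rw [val_inf, sigma_two, oplus_odot, inf_assoc, inf_eq_right.2 z.le_one, inf_sup_right,
      inf_eq_left.2 z.zero_le]

end UnitInterval

theorem ULMHom.monotone {M N : Type u} [ULMOps M] [IsULM M] [ULMOps N] [IsULM N]
    (f : ULMHom M N) {x y : M} (h : x ≤ y) : f.toFun x ≤ f.toFun y := by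
  rw [← sup_eq_right] at h ⊢
  rw [← f.map_sup, h]

/-- The functor `Γ`: it sends `M` to its unit interval and a homomorphism to its restriction. -/
def Gamma : ULM.{u} ⥤ MVM.{u} where
  obj M := ⟨UnitInterval M⟩
  map {M N} f :=
    { toFun := fun x => ⟨f.toFun x.val,
        f.map_zero.symm.trans_le (ULMHom.monotone f x.zero_le),
        (ULMHom.monotone f x.le_one).trans_eq f.map_one⟩
      map_oplus := fun x y => UnitInterval.ext <| by
        change f.toFun ((x.val + y.val) ⊓ 1) = (f.toFun x.val + f.toFun y.val) ⊓ 1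
        rw [f.map_inf, f.map_add, f.map_one]
      map_odot := fun x y => UnitInterval.ext <| by
        change f.toFun ((x.val + y.val + ULMOps.negOne) ⊔ 0) =
          (f.toFun x.val + f.toFun y.val + ULMOps.negOne) ⊔ 0
        rw [f.map_sup, f.map_add, f.map_add, f.map_zero, f.map_negOne]
      map_sup := fun x y => UnitInterval.ext (f.map_sup _ _)
      map_inf := fun x y => UnitInterval.ext (f.map_inf _ _)
      map_zero := UnitInterval.ext f.map_zero
      map_one := UnitInterval.ext f.map_one }

/-! ### Good `ℤ`-sequences -/

section Good

/-- Good pairs. -/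
def IsGoodPair {A : Type u} [MVMOps A] (x y : A) : Prop := x ⊕ₘ y = x ∧ x ⊙ₘ y = y

/-- Good `ℤ`-sequences. -/
structure IsGoodSeq {A : Type u} [MVMOps A] (x : ℤ → A) : Prop where
  eventually_one : ∃ n : ℤ, ∀ k < n, x k = 1
  eventually_zero : ∃ m : ℤ, ∀ k ≥ m, x k = 0
  good (k : ℤ) : IsGoodPair (x k) (x (k + 1))

/-- The set `Ξ(A)` of good `ℤ`-sequences in `A`. -/
@[ext]
structure GoodSeq (A : Type u) [MVMOps A] : Type u where
  seq : ℤ → A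
  isGoodSeq : IsGoodSeq seq

variable {A : Type u} [MVMOps A] [IsMVM A]

theorem mvm_sup_idem (a : A) : a ⊔ a = a := by
  conv_lhs => rw [← IsMVM.inf_sup_self a a]
  exact (congrArg (· ⊔ _) (IsMVM.inf_sup_self a a)).trans (IsMVM.sup_inf_self a _)

theorem mvm_inf_idem (a : A) : a ⊓ a = a := by
  conv_lhs => rw [← IsMVM.sup_inf_self a a]
  exact (congrArg (· ⊓ _) (IsMVM.sup_inf_self a a)).trans (IsMVM.inf_sup_self a _)

theorem mvm_le_one (x : A) : x ⊓ 1 = x := by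
  have h := IsMVM.ax7 x 0 (1 : A)
  rw [IsMVM.odot_one, IsMVM.oplus_zero] at h
  rw [h, IsMVM.inf_assoc, mvm_inf_idem]

theorem mvm_zero_le (x : A) : x ⊔ 0 = x := by
  have h := IsMVM.ax6 x 1 (0 : A)
  rw [IsMVM.oplus_zero, IsMVM.odot_one] at h
  rw [h, IsMVM.sup_assoc, mvm_sup_idem]

theorem oplus_one (x : A) : x ⊕ₘ 1 = 1 := by
  have h := IsMVM.ax6 x 1 (1 : A)
  rw [IsMVM.odot_one] at h
  rw [h, IsMVM.sup_comm, ← mvm_le_one (_ ⊙ₘ _), IsMVM.inf_comm, IsMVM.sup_inf_self]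

theorem odot_zero (x : A) : x ⊙ₘ 0 = 0 := by
  have h := IsMVM.ax7 x 0 (0 : A)
  rw [IsMVM.oplus_zero] at h
  rw [h, IsMVM.inf_comm, ← mvm_zero_le (_ ⊕ₘ _), IsMVM.sup_comm, IsMVM.inf_sup_self]

variable (A) in
/-- The commutative monoid `⟨A; ⊙, 1⟩`, written multiplicatively. -/
@[reducible]
def odotMonoid : CommMonoid A where
  mul := MVMOps.odot
  one := 1
  mul_assoc := IsMVM.odot_assoc
  mul_comm := IsMVM.odot_comm
  one_mul x := (IsMVM.odot_comm 1 x).trans (IsMVM.odot_one x)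
  mul_one := IsMVM.odot_one

/-- `⨀ k : ℤ, x k`, for a family all but finitely many members of which are `1`. -/
noncomputable def bigOdot (x : ℤ → A) : A :=
  letI := odotMonoid A
  ∏ᶠ k : ℤ, x k

/-- The sum of `ℤ`-sequences, `(a + b)(n) = ⨀ k, a(k) ⊕ b(n - k)`. -/
noncomputable def seqAdd (a b : ℤ → A) (n : ℤ) : A :=
  bigOdot fun k => a k ⊕ₘ b (n - k)

/-- All but finitely many factors in the definition of the sum of good sequences are `1`. -/
theorem finite_ne_one (a b : GoodSeq A) (n : ℤ) :
    {k : ℤ | a.seq k ⊕ₘ b.seq (n - k) ≠ 1}.Finite := by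
  obtain ⟨p, hp⟩ := a.isGoodSeq.eventually_one
  obtain ⟨q, hq⟩ := b.isGoodSeq.eventually_one
  refine (Set.finite_Icc p (n - q)).subset fun k hk => ?_
  by_contra hk'
  apply hk
  rcases lt_or_ge k p with h | h
  · rw [hp k h, IsMVM.oplus_comm, oplus_one]
  · have h2 : n - k < q := by
      by_contra h3
      exact hk' ⟨h, by omega⟩
    rw [hq _ h2, oplus_one]

/-- The `ℤ`-sequence that is `1` below `m` and `0` from `m` on. -/
def stepSeq (A : Type u) [MVMOps A] (m n : ℤ) : A := if n < m then 1 else 0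

theorem isGoodSeq_stepSeq (m : ℤ) : IsGoodSeq (stepSeq A m) where
  eventually_one := ⟨m, fun _ hk => if_pos hk⟩
  eventually_zero := ⟨m, fun _ hk => if_neg (not_lt.2 hk)⟩
  good k := by
    unfold stepSeq IsGoodPair
    split_ifs with h1 h2
    · exact ⟨oplus_one 1, IsMVM.odot_one 1⟩
    · exact ⟨IsMVM.oplus_zero 1, odot_zero 1⟩
    · omega
    · exact ⟨IsMVM.oplus_zero 0, odot_zero 0⟩

/-- Good `ℤ`-sequences in `A` are closed under the componentwise operations `∨`, `∧` and under the
sum of `ℤ`-sequences. -/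
structure GoodClosed (A : Type u) [MVMOps A] [IsMVM A] : Prop where
  sup (a b : GoodSeq A) : IsGoodSeq fun n => a.seq n ⊔ b.seq n
  inf (a b : GoodSeq A) : IsGoodSeq fun n => a.seq n ⊓ b.seq n
  add (a b : GoodSeq A) : IsGoodSeq (seqAdd a.seq b.seq)

/-- The operations on `Ξ(A)`. -/
@[reducible]
noncomputable def goodSeqOps (h : GoodClosed A) : ULMOps (GoodSeq A) where
  add a b := ⟨seqAdd a.seq b.seq, h.add a b⟩
  max a b := ⟨fun n => a.seq n ⊔ b.seq n, h.sup a b⟩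
  min a b := ⟨fun n => a.seq n ⊓ b.seq n, h.inf a b⟩
  zero := ⟨stepSeq A 0, isGoodSeq_stepSeq 0⟩
  one := ⟨stepSeq A 1, isGoodSeq_stepSeq 1⟩
  negOne := ⟨stepSeq A (-1), isGoodSeq_stepSeq (-1)⟩

variable {B : Type u} [MVMOps B] [IsMVM B]

/-- The map `Ξ(f)`, `Ξ(f)(x)(n) = f(x(n))`. -/
def goodSeqMap (f : MVMHom A B) (x : GoodSeq A) : GoodSeq B where
  seq n := f.toFun (x.seq n)
  isGoodSeq :=
    { eventually_one := x.isGoodSeq.eventually_one.imp fun _ h k hk => by rw [h k hk, f.map_one]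
      eventually_zero := x.isGoodSeq.eventually_zero.imp fun _ h k hk => by rw [h k hk, f.map_zero]
      good := fun k => ⟨by rw [← f.map_oplus, (x.isGoodSeq.good k).1],
        by rw [← f.map_odot, (x.isGoodSeq.good k).2]⟩ }

theorem map_seqAdd (f : MVMHom A B) (a b : GoodSeq A) (n : ℤ) :
    f.toFun (seqAdd a.seq b.seq n) = seqAdd (goodSeqMap f a).seq (goodSeqMap f b).seq n := by
  let _ := odotMonoid A
  let _ := odotMonoid B
  let F : A →* B := { toFun := f.toFun, map_one' := f.map_one, map_mul' := f.map_odot }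
  refine (F.map_finprod (f := fun k : ℤ => a.seq k ⊕ₘ b.seq (n - k)) (finite_ne_one a b n)).trans ?_
  exact finprod_congr fun k => f.map_oplus _ _

end Good

theorem map_stepSeq {A B : Type u} [MVMOps A] [MVMOps B] (f : MVMHom A B) (m n : ℤ) :
    f.toFun (stepSeq A m n) = stepSeq B m n := by
  unfold stepSeq
  split_ifs
  exacts [f.map_one, f.map_zero]

/-- The functor `Ξ`: it sends `A` to the algebra of good `ℤ`-sequences in `A`, and `f` to the
componentwise application of `f`. Its arguments are the facts that make this well defined: that good
`ℤ`-sequences are closed under the operations, and that they form a unital commutative distributive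
ℓ-monoid. -/
noncomputable def Xi (hc : ∀ A : MVM.{u}, GoodClosed A)
    (hΞ : ∀ A : MVM.{u}, @IsULM (GoodSeq A) (goodSeqOps (hc A))) : MVM.{u} ⥤ ULM.{u} where
  obj A := @ULM.mk (GoodSeq A) (goodSeqOps (hc A)) (hΞ A)
  map {A B} f :=
    letI := goodSeqOps (hc A)
    letI := goodSeqOps (hc B)
    { toFun := goodSeqMap f
      map_add := fun a b => GoodSeq.ext (funext fun n => map_seqAdd f a b n)
      map_sup := fun _ _ => GoodSeq.ext (funext fun _ => f.map_sup _ _)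
      map_inf := fun _ _ => GoodSeq.ext (funext fun _ => f.map_inf _ _)
      map_zero := GoodSeq.ext (funext fun n => map_stepSeq f 0 n)
      map_one := GoodSeq.ext (funext fun n => map_stepSeq f 1 n)
      map_negOne := GoodSeq.ext (funext fun n => map_stepSeq f (-1) n) }

end MVMonoidal

/-! Everything about `Ξ(A)` is reduced to algebras in which every good pair `(x, y)` has `x = 1` or
`y = 0`. There a good `ℤ`-sequence is a single element `x` at some position `n`, preceded by ones
and followed by zeros: it behaves like the number `n + x`, and sums of such sequences are explicit.

The reduction (`eq_of_forall_hom`) is a subdirect representation. If `a ≰ b`, Zorn's lemma gives a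
maximal compatible preorder not relating `a` to `b`. A nontrivial good pair `(x, y)` in its quotient
would yield two strictly larger preorders, one forcing `y ≤ 0` and one forcing `1 ≤ x`. By
maximality both relate `a` to `b`, so `a ≤ b ⊕ ny` and `a ⊙ x^m ≤ b`; but for a good pair these
imply `a ≤ b` (`IsGoodPair.le_of_le`). Since goodness and the equational axioms of `Ξ(A)` are
equations in `A`, they can be checked in such quotients.

For the equivalence, a good sequence between `0` and `1` is determined by its value at `0`, so
`ΓΞ(A) ≅ A`. Conversely `x ↦ (n ↦ ((x - n) ∨ 0) ∧ 1)` maps `M` to `ΞΓ(M)`. An element is an integer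
constant plus its finitely many truncations in a window containing it; this gives injectivity, and
the resulting induction principle gives additivity and surjectivity. -/

namespace MVMonoidal

/-! ### Order, the symmetric ternary term, and good pairs -/

section Basic

variable {A : Type u} [MVMOps A] [IsMVM A]

/-- The distributive lattice underlying an MV-monoidal algebra. -/
instance mvmLattice : DistribLattice A :=
  { Lattice.mk' IsMVM.sup_comm IsMVM.sup_assoc IsMVM.inf_comm IsMVM.inf_assoc
      IsMVM.sup_inf_self IsMVM.inf_sup_self with
    le_sup_inf := by
      let _ : Lattice A := Lattice.mk' IsMVM.sup_comm IsMVM.sup_assoc IsMVM.inf_comm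
        IsMVM.inf_assoc IsMVM.sup_inf_self IsMVM.inf_sup_self
      exact (DistribLattice.ofInfSupLe (α := A)
        (fun a b c => (IsMVM.inf_sup_left a b c).le)).le_sup_inf }

theorem le_one' (x : A) : x ≤ 1 := inf_eq_left.1 (mvm_le_one x)

theorem zero_le' (x : A) : 0 ≤ x := sup_eq_left.1 (mvm_zero_le x)

theorem zero_oplus (x : A) : 0 ⊕ₘ x = x := by rw [IsMVM.oplus_comm, IsMVM.oplus_zero]

theorem one_oplus (x : A) : 1 ⊕ₘ x = 1 := by rw [IsMVM.oplus_comm, oplus_one]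

theorem one_odot (x : A) : 1 ⊙ₘ x = x := by rw [IsMVM.odot_comm, IsMVM.odot_one]

theorem oplus_le_oplus_left {x y : A} (h : x ≤ y) (z : A) : z ⊕ₘ x ≤ z ⊕ₘ y := by
  rw [← sup_eq_right] at h ⊢
  rw [← IsMVM.oplus_sup, h]

theorem odot_le_odot_left {x y : A} (h : x ≤ y) (z : A) : z ⊙ₘ x ≤ z ⊙ₘ y := by
  rw [← sup_eq_right] at h ⊢
  rw [← IsMVM.odot_sup, h]

theorem oplus_le_oplus_right {x y : A} (h : x ≤ y) (z : A) : x ⊕ₘ z ≤ y ⊕ₘ z := by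
  rw [IsMVM.oplus_comm x, IsMVM.oplus_comm y]
  exact oplus_le_oplus_left h z

theorem odot_le_odot_right {x y : A} (h : x ≤ y) (z : A) : x ⊙ₘ z ≤ y ⊙ₘ z := by
  rw [IsMVM.odot_comm x, IsMVM.odot_comm y]
  exact odot_le_odot_left h z

theorem odot_le_odot {x y z w : A} (h : x ≤ y) (h' : z ≤ w) : x ⊙ₘ z ≤ y ⊙ₘ w :=
  (odot_le_odot_right h z).trans (odot_le_odot_left h' y)

theorem le_oplus_right (x y : A) : x ≤ x ⊕ₘ y :=
  (IsMVM.oplus_zero x).symm.trans_le (oplus_le_oplus_left (zero_le' y) x)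

theorem le_oplus_left (x y : A) : x ≤ y ⊕ₘ x :=
  (le_oplus_right x y).trans_eq (IsMVM.oplus_comm x y)

theorem odot_le_left (x y : A) : x ⊙ₘ y ≤ x :=
  (odot_le_odot_left (le_one' y) x).trans_eq (IsMVM.odot_one x)

theorem odot_le_right (x y : A) : x ⊙ₘ y ≤ y :=
  (IsMVM.odot_comm x y).trans_le (odot_le_left y x)

/-- The term `(x ⊕ y) ⊙ ((x ⊙ y) ⊕ z)` is invariant under cyclic permutations. -/
theorem oplus_odot_cycle (x y z : A) :
    (x ⊕ₘ y) ⊙ₘ ((x ⊙ₘ y) ⊕ₘ z) = (y ⊕ₘ z) ⊙ₘ ((y ⊙ₘ z) ⊕ₘ x) := by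
  have h (x y z : A) :
      (x ⊕ₘ y) ⊙ₘ ((x ⊙ₘ y) ⊕ₘ z) = (z ⊕ₘ x) ⊙ₘ ((z ⊙ₘ x) ⊕ₘ y) := by
    rw [IsMVM.ax4, IsMVM.oplus_comm, IsMVM.odot_comm x, IsMVM.ax5, IsMVM.odot_comm,
      IsMVM.oplus_comm y]
  rw [h, h]

/-- By `ax5` the right side is a cyclic rotation of the left. In a unit interval both are `x + y + z
- 1` truncated to `[0, 1]`. -/
theorem oplus_odot_eq (x y z : A) :
    (x ⊕ₘ y) ⊙ₘ ((x ⊙ₘ y) ⊕ₘ z) = (x ⊙ₘ y) ⊕ₘ ((x ⊕ₘ y) ⊙ₘ z) := by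
  rw [IsMVM.ax5, oplus_odot_cycle, IsMVM.odot_comm, IsMVM.oplus_comm _ x]

/-- The cases `z = 1` and `z = 0` of `oplus_odot_eq`. This is why sums of one-entry sequences are
good. -/
theorem isGoodPair_oplus_odot (x y : A) : IsGoodPair (x ⊕ₘ y) (x ⊙ₘ y) := by
  constructor
  · have h := oplus_odot_eq x y 1
    rw [oplus_one, IsMVM.odot_one] at h
    rw [IsMVM.oplus_comm, ← h]
  · have h := oplus_odot_eq x y 0
    rwa [odot_zero, IsMVM.oplus_zero] at h

/-- The ternary term lies between the two sides. This inequality makes the preorders generated by `y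
≤ 0` and by `1 ≤ x` compatible with `⊙` and `⊕` respectively. -/
theorem oplus_odot_le (x y z : A) : (x ⊕ₘ y) ⊙ₘ z ≤ (x ⊙ₘ z) ⊕ₘ y :=
  calc (x ⊕ₘ y) ⊙ₘ z ≤ (x ⊙ₘ y) ⊕ₘ ((x ⊕ₘ y) ⊙ₘ z) := le_oplus_left _ _
    _ = (z ⊕ₘ x) ⊙ₘ ((z ⊙ₘ x) ⊕ₘ y) := by
      rw [← oplus_odot_eq, oplus_odot_cycle z x y]
    _ ≤ (x ⊙ₘ z) ⊕ₘ y := by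
      rw [IsMVM.odot_comm z x]
      exact odot_le_right _ _

/-- For a good pair, `ax6` gives `b ⊕ y = (y ⊕ (x ⊙ b)) ∨ b` and `ax7` gives `x ⊙ a = (y ⊕ (x ⊙ a))
∧ a`. Meeting the first with `a` splits `a` into two parts; when `b ≤ a`, the first part is below `x
⊙ a`, hence below `b`. -/
theorem IsGoodPair.le_of_le {x y a b : A} (h : IsGoodPair x y) (h₁ : a ≤ b ⊕ₘ y)
    (h₀ : a ⊙ₘ x ≤ b) : a ≤ b := by
  -- Both hypotheses survive replacing `b` by `a ⊓ b`.
  wlog hba : b ≤ a generalizing b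
  · refine (this (b := a ⊓ b) ?_ ?_ inf_le_left).trans inf_le_right
    · rw [IsMVM.oplus_comm, IsMVM.oplus_inf, IsMVM.oplus_comm y b]
      exact le_inf (le_oplus_left a y) h₁
    · exact le_inf (odot_le_left a x) h₀
  have h6 := IsMVM.ax6 x y b
  have h7 := IsMVM.ax7 x y a
  have hs := oplus_odot_eq x y b
  rw [h.1, h.2] at h6 h7 hs
  rw [hs] at h6
  have hle : a ⊓ (y ⊕ₘ (x ⊙ₘ b)) ≤ b := by
    refine le_trans ?_ h₀
    rw [IsMVM.odot_comm a x, h7, inf_comm a]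
    exact inf_le_inf_right _ (oplus_le_oplus_left (odot_le_odot_left hba x) y)
  calc a ≤ a ⊓ (b ⊕ₘ y) := le_inf le_rfl h₁
    _ = (a ⊓ (y ⊕ₘ (x ⊙ₘ b))) ⊔ (a ⊓ b) := by rw [IsMVM.oplus_comm b y, h6, inf_sup_left]
    _ ≤ b := sup_le hle inf_le_right

end Basic

/-! ### Compatible preorders and the subdirect representation -/

section Preorders

/-- Preorders on `A` that extend the lattice order and make all operations monotone. -/
structure IsCompatible {A : Type u} [MVMOps A] [IsMVM A] (r : A → A → Prop) : Prop where
  of_le {a b : A} : a ≤ b → r a b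
  trans {a b c : A} : r a b → r b c → r a c
  oplus {a b : A} (c : A) : r a b → r (a ⊕ₘ c) (b ⊕ₘ c)
  odot {a b : A} (c : A) : r a b → r (a ⊙ₘ c) (b ⊙ₘ c)
  sup {a b : A} (c : A) : r a b → r (a ⊔ c) (b ⊔ c)
  inf {a b : A} (c : A) : r a b → r (a ⊓ c) (b ⊓ c)

variable {A : Type u} [MVMOps A] [IsMVM A]

theorem isCompatible_le : IsCompatible (A := A) (· ≤ ·) where
  of_le := id
  trans := le_trans
  oplus c h := oplus_le_oplus_right h c
  odot c h := odot_le_odot_right h c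
  sup c h := sup_le_sup_right h c
  inf c h := inf_le_inf_right c h

namespace IsCompatible

theorem map₂ {r : A → A → Prop} (h : IsCompatible r) {m : A → A → A} (hm : ∀ a b, m a b = m b a)
    (hr : ∀ {a b : A} (c : A), r a b → r (m a c) (m b c)) {a b c d : A} (h₁ : r a b) (h₂ : r c d) :
    r (m a c) (m b d) :=
  h.trans (hr c h₁) (by rw [hm b c, hm b d]; exact hr b h₂)

/-- The congruence given by a compatible preorder. -/
def setoid {r : A → A → Prop} (h : IsCompatible r) : Setoid A where
  r a b := r a b ∧ r b a
  iseqv := ⟨fun _ => ⟨h.of_le le_rfl, h.of_le le_rfl⟩, fun h => ⟨h.2, h.1⟩,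
    fun h₁ h₂ => ⟨h.trans h₁.1 h₂.1, h.trans h₂.2 h₁.2⟩⟩

/-- The quotient by the congruence given by a compatible preorder. -/
def Quot {r : A → A → Prop} (h : IsCompatible r) : Type u := Quotient h.setoid

variable {r : A → A → Prop} (h : IsCompatible r)

/-- The class of an element. -/
def cls (a : A) : h.Quot := Quotient.mk h.setoid a

/-- The operation induced on the quotient by a compatible operation. -/
def lift₂ (m : A → A → A) (hm : ∀ a b, m a b = m b a)
    (hr : ∀ {a b : A} (c : A), r a b → r (m a c) (m b c)) (x y : h.Quot) : h.Quot :=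
  Quotient.map₂ (sa := h.setoid) (sb := h.setoid) (sc := h.setoid) m
    (fun _ _ h₁ _ _ h₂ => ⟨h.map₂ hm hr h₁.1 h₂.1, h.map₂ hm hr h₁.2 h₂.2⟩) x y

instance : MVMOps h.Quot where
  oplus := h.lift₂ _ IsMVM.oplus_comm h.oplus
  odot := h.lift₂ _ IsMVM.odot_comm h.odot
  max := h.lift₂ _ IsMVM.sup_comm h.sup
  min := h.lift₂ _ IsMVM.inf_comm h.inf
  zero := h.cls 0
  one := h.cls 1

theorem forall_quot {p : h.Quot → Prop} : (∀ x, p x) ↔ ∀ a, p (h.cls a) :=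
  ⟨fun H _ => H _, fun H x => Quotient.inductionOn x H⟩

theorem cls_oplus (a b : A) : h.cls a ⊕ₘ h.cls b = h.cls (a ⊕ₘ b) := rfl
theorem cls_odot (a b : A) : h.cls a ⊙ₘ h.cls b = h.cls (a ⊙ₘ b) := rfl
theorem cls_sup (a b : A) : h.cls a ⊔ h.cls b = h.cls (a ⊔ b) := rfl
theorem cls_inf (a b : A) : h.cls a ⊓ h.cls b = h.cls (a ⊓ b) := rfl
theorem cls_zero : (0 : h.Quot) = h.cls 0 := rfl
theorem cls_one : (1 : h.Quot) = h.cls 1 := rfl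

instance : IsMVM h.Quot := by
  constructor <;>
    simp only [h.forall_quot, cls_oplus, cls_odot, cls_sup, cls_inf, cls_zero, cls_one] <;> intros <;>
    apply congrArg h.cls
  · apply IsMVM.sup_comm
  · apply IsMVM.inf_comm
  · apply IsMVM.sup_assoc
  · apply IsMVM.inf_assoc
  · apply IsMVM.sup_inf_self
  · apply IsMVM.inf_sup_self
  · apply IsMVM.inf_sup_left
  · apply IsMVM.oplus_assoc
  · apply IsMVM.oplus_comm
  · apply IsMVM.oplus_zero
  · apply IsMVM.odot_assoc
  · apply IsMVM.odot_comm
  · apply IsMVM.odot_one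
  · apply IsMVM.oplus_sup
  · apply IsMVM.oplus_inf
  · apply IsMVM.odot_sup
  · apply IsMVM.odot_inf
  · apply IsMVM.ax4
  · apply IsMVM.ax5
  · apply IsMVM.ax6
  · apply IsMVM.ax7

/-- The quotient map. -/
def clsHom : MVMHom A h.Quot where
  toFun := h.cls
  map_oplus _ _ := rfl
  map_odot _ _ := rfl
  map_sup _ _ := rfl
  map_inf _ _ := rfl
  map_zero := rfl
  map_one := rfl

theorem cls_le_cls {a b : A} : h.cls a ≤ h.cls b ↔ r a b := by
  rw [← sup_eq_right]
  refine ⟨fun H => ?_, fun H => ?_⟩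
  · exact h.trans (h.of_le le_sup_left) (Quotient.exact H).1
  · refine Quotient.sound ⟨?_, h.of_le le_sup_right⟩
    have := h.sup b H
    rwa [sup_idem] at this

/-- Applied to a quotient map, this brings preorders on the quotient back to `A`, where maximality
can be used. -/
theorem comap {B : Type u} [MVMOps B] [IsMVM B] (f : MVMHom A B) {s : B → B → Prop}
    (hs : IsCompatible s) : IsCompatible fun a b => s (f.toFun a) (f.toFun b) where
  of_le {a b} hab := hs.of_le <| by
    rw [← sup_eq_right] at hab ⊢
    rw [← f.map_sup, hab]
  trans := hs.trans
  oplus c H := by rw [f.map_oplus, f.map_oplus]; exact hs.oplus _ H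
  odot c H := by rw [f.map_odot, f.map_odot]; exact hs.odot _ H
  sup c H := by rw [f.map_sup, f.map_sup]; exact hs.sup _ H
  inf c H := by rw [f.map_inf, f.map_inf]; exact hs.inf _ H

end IsCompatible

/-- The `n`-fold sum `y ⊕ ⋯ ⊕ y`. -/
def multiple (y : A) : ℕ → A
  | 0 => 0
  | n + 1 => multiple y n ⊕ₘ y

/-- The `n`-fold product `x ⊙ ⋯ ⊙ x`. -/
def power (x : A) : ℕ → A
  | 0 => 1
  | n + 1 => power x n ⊙ₘ x

theorem multiple_add (y : A) (n m : ℕ) : multiple y (n + m) = multiple y n ⊕ₘ multiple y m := by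
  induction m with
  | zero => exact (IsMVM.oplus_zero _).symm
  | succ m ih => rw [← add_assoc, multiple, multiple, ih, IsMVM.oplus_assoc]

theorem power_add (x : A) (n m : ℕ) : power x (n + m) = power x n ⊙ₘ power x m := by
  induction m with
  | zero => exact (IsMVM.odot_one _).symm
  | succ m ih => rw [← add_assoc, power, power, ih, IsMVM.odot_assoc]

/-- The least compatible preorder in which `y` lies below `0`. -/
theorem isCompatible_multiple (y : A) : IsCompatible fun a b => ∃ n, a ≤ b ⊕ₘ multiple y n where
  of_le {a b} h := ⟨0, h.trans_eq (IsMVM.oplus_zero b).symm⟩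
  trans := by
    rintro a b c ⟨n, hn⟩ ⟨m, hm⟩
    refine ⟨m + n, hn.trans ?_⟩
    rw [multiple_add, ← IsMVM.oplus_assoc]
    exact oplus_le_oplus_right hm _
  oplus := by
    rintro a b c ⟨n, hn⟩
    refine ⟨n, (oplus_le_oplus_right hn c).trans_eq ?_⟩
    rw [IsMVM.oplus_assoc, IsMVM.oplus_comm _ c, IsMVM.oplus_assoc]
  odot := by
    rintro a b c ⟨n, hn⟩
    exact ⟨n, (odot_le_odot_right hn c).trans (oplus_odot_le _ _ _)⟩
  sup := by
    rintro a b c ⟨n, hn⟩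
    exact ⟨n, sup_le (hn.trans (oplus_le_oplus_right le_sup_left _))
      (le_sup_right.trans (le_oplus_right _ _))⟩
  inf := by
    rintro a b c ⟨n, hn⟩
    refine ⟨n, ?_⟩
    rw [IsMVM.oplus_comm, IsMVM.oplus_inf]
    exact inf_le_inf (hn.trans_eq (IsMVM.oplus_comm _ _)) (le_oplus_left _ _)

/-- The least compatible preorder in which `1` lies below `x`. -/
theorem isCompatible_power (x : A) : IsCompatible fun a b => ∃ n, a ⊙ₘ power x n ≤ b where
  of_le {a b} h := ⟨0, (IsMVM.odot_one a).trans_le h⟩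
  trans := by
    rintro a b c ⟨n, hn⟩ ⟨m, hm⟩
    refine ⟨n + m, ?_⟩
    rw [power_add, ← IsMVM.odot_assoc]
    exact (odot_le_odot_right hn _).trans hm
  oplus := by
    rintro a b c ⟨n, hn⟩
    exact ⟨n, (oplus_odot_le _ _ _).trans (oplus_le_oplus_right hn c)⟩
  odot := by
    rintro a b c ⟨n, hn⟩
    refine ⟨n, le_of_eq_of_le ?_ (odot_le_odot_right hn c)⟩
    rw [IsMVM.odot_assoc, IsMVM.odot_comm c, IsMVM.odot_assoc]
  sup := by
    rintro a b c ⟨n, hn⟩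
    refine ⟨n, ?_⟩
    rw [IsMVM.odot_comm, IsMVM.odot_sup]
    exact sup_le_sup ((IsMVM.odot_comm _ _).trans_le hn) (odot_le_right _ _)
  inf := by
    rintro a b c ⟨n, hn⟩
    exact ⟨n, le_inf ((odot_le_odot_right inf_le_left _).trans hn)
      ((odot_le_left _ _).trans inf_le_right)⟩

/-- Each use of `IsGoodPair.le_of_le` strips one factor `x`; once all are gone, one summand `y` has
been removed. -/
theorem IsGoodPair.le_of_multiple_of_power {x y a b : A} (h : IsGoodPair x y) {n m : ℕ}
    (h₁ : a ≤ b ⊕ₘ multiple y n) (h₀ : a ⊙ₘ power x m ≤ b) : a ≤ b := by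
  have key (b : A) (m : ℕ) (h₁ : a ≤ b ⊕ₘ y) (h₀ : a ⊙ₘ power x m ≤ b) : a ≤ b := by
    induction m with
    | zero => exact (IsMVM.odot_one a).symm.trans_le h₀
    | succ m ih =>
      refine ih (h.le_of_le ((odot_le_left _ _).trans h₁) ?_)
      rwa [IsMVM.odot_assoc]
  induction n with
  | zero => exact h₁.trans_eq (IsMVM.oplus_zero b)
  | succ n ih =>
    rw [multiple, ← IsMVM.oplus_assoc] at h₁
    exact ih (key _ m h₁ (h₀.trans (le_oplus_right _ _)))

variable (A) in
/-- In every good pair the first entry is `1` or the second one is `0`. -/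
def GoodPairsTrivial : Prop := ∀ x y : A, IsGoodPair x y → x = 1 ∨ y = 0

theorem exists_hom_not_le {a b : A} (hab : ¬ a ≤ b) :
    ∃ (B : Type u) (_ : MVMOps B) (_ : IsMVM B) (f : MVMHom A B),
      GoodPairsTrivial B ∧ ¬ f.toFun a ≤ f.toFun b := by
  obtain ⟨r, -, hr⟩ := zorn_le_nonempty₀ {r : A → A → Prop | IsCompatible r ∧ ¬ r a b}
    (fun c hc hchain r₀ hr₀ => by
      -- Two relations witnessed in a chain hold together in its larger member; transitivity of the
      -- union needs this.
      have hdir {x y z w : A} (h₁ : ∃ r ∈ c, r x y) (h₂ : ∃ r ∈ c, r z w) :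
          ∃ r ∈ c, r x y ∧ r z w := by
        obtain ⟨r, hr, h⟩ := h₁
        obtain ⟨s, hs, h'⟩ := h₂
        rcases hchain.total hr hs with H | H
        · exact ⟨s, hs, H _ _ h, h'⟩
        · exact ⟨r, hr, h, H _ _ h'⟩
      refine ⟨fun x y => ∃ r ∈ c, r x y, ⟨⟨?_, ?_, ?_, ?_, ?_, ?_⟩, ?_⟩, fun z hz x y h => ⟨z, hz, h⟩⟩
      · exact fun h => ⟨r₀, hr₀, (hc hr₀).1.of_le h⟩
      · intro x y z h₁ h₂
        obtain ⟨r, hr, h, h'⟩ := hdir h₁ h₂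
        exact ⟨r, hr, (hc hr).1.trans h h'⟩
      · exact fun z ⟨r, hr, h⟩ => ⟨r, hr, (hc hr).1.oplus z h⟩
      · exact fun z ⟨r, hr, h⟩ => ⟨r, hr, (hc hr).1.odot z h⟩
      · exact fun z ⟨r, hr, h⟩ => ⟨r, hr, (hc hr).1.sup z h⟩
      · exact fun z ⟨r, hr, h⟩ => ⟨r, hr, (hc hr).1.inf z h⟩
      · exact fun ⟨r, hr, h⟩ => (hc hr).2 h) (· ≤ ·) ⟨isCompatible_le, hab⟩
  have h := hr.prop.1
  -- Maximality of `r`: any compatible preorder on the quotient that properly extends `≤` relates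
  -- `a` to `b`.
  have hmax {s : h.Quot → h.Quot → Prop} (hs : IsCompatible s) {x y : h.Quot} (hxy : s x y)
      (hxy' : ¬ x ≤ y) : s (h.cls a) (h.cls b) := by
    by_contra hsab
    obtain ⟨x, rfl⟩ := Quotient.exists_rep x
    obtain ⟨y, rfl⟩ := Quotient.exists_rep y
    refine hxy' (h.cls_le_cls.2 (hr.le_of_ge ⟨hs.comap h.clsHom, hsab⟩ ?_ _ _ hxy))
    exact fun x y H => hs.of_le (h.cls_le_cls.2 H)
  refine ⟨h.Quot, inferInstance, inferInstance, h.clsHom, fun x y hxy => ?_,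
    fun H => hr.prop.2 (h.cls_le_cls.1 H)⟩
  by_contra! hne
  obtain ⟨n, hn⟩ := hmax (isCompatible_multiple y) (x := y) (y := 0)
    ⟨1, le_of_eq (by rw [multiple, multiple, zero_oplus, zero_oplus])⟩
    fun H => hne.2 (H.antisymm (zero_le' y))
  obtain ⟨m, hm⟩ := hmax (isCompatible_power x) (x := 1) (y := x)
    ⟨1, le_of_eq (by rw [power, power, one_odot, one_odot])⟩
    fun H => hne.1 ((le_one' x).antisymm H)
  exact hr.prop.2 (h.cls_le_cls.1 (hxy.le_of_multiple_of_power hn hm))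

/-- Hence `A` embeds in a product of algebras with trivial good pairs, and equations may be tested
there. -/
theorem eq_of_forall_hom {a b : A}
    (h : ∀ (B : Type u) [MVMOps B] [IsMVM B] (f : MVMHom A B),
      GoodPairsTrivial B → f.toFun a = f.toFun b) : a = b := by
  refine le_antisymm ?_ ?_ <;> by_contra hab <;>
    obtain ⟨B, _, _, f, hB, hf⟩ := exists_hom_not_le hab
  exacts [hf (h B f hB).le, hf (h B f hB).ge]

end Preorders

/-! ### One-entry sequences and closure of good sequences -/

section Sequences

variable {A : Type u} [MVMOps A]

/-- The `ℤ`-sequence that is `1` below `n`, `x` at `n`, and `0` above `n`. -/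
def single (n : ℤ) (x : A) (k : ℤ) : A := if k < n then 1 else if k = n then x else 0

theorem single_of_lt {n k : ℤ} (h : k < n) (x : A) : single n x k = 1 := if_pos h

theorem single_self (n : ℤ) (x : A) : single n x n = x := by simp [single]

theorem single_of_gt {n k : ℤ} (h : n < k) (x : A) : single n x k = 0 := by
  rw [single, if_neg h.not_gt, if_neg h.ne']

theorem stepSeq_eq_single (m : ℤ) : stepSeq A m = single m 0 := by
  funext k
  simp [stepSeq, single]

theorem goodSeqMap_seq {B : Type u} [MVMOps B] (f : MVMHom A B) (a : GoodSeq A) (k : ℤ) :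
    (goodSeqMap f a).seq k = f.toFun (a.seq k) := rfl

theorem GoodSeq.ext' {a b : GoodSeq A} (h : ∀ k, a.seq k = b.seq k) : a = b :=
  GoodSeq.ext (funext h)

variable [IsMVM A]

theorem IsGoodPair.le {x y : A} (h : IsGoodPair x y) : y ≤ x :=
  h.2.symm.trans_le (odot_le_left x y)

theorem isGoodPair_one (x : A) : IsGoodPair 1 x := ⟨one_oplus x, one_odot x⟩

theorem isGoodPair_zero (x : A) : IsGoodPair x 0 := ⟨IsMVM.oplus_zero x, odot_zero x⟩

theorem isGoodSeq_single (n : ℤ) (x : A) : IsGoodSeq (single n x) where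
  eventually_one := ⟨n, fun _ hk => single_of_lt hk x⟩
  eventually_zero := ⟨n + 1, fun _ hk => single_of_gt (by omega) x⟩
  good k := by
    rcases lt_or_ge k n with h | h
    · rw [single_of_lt h]
      exact isGoodPair_one _
    · rw [single_of_gt (n := n) (k := k + 1) (by omega)]
      exact isGoodPair_zero _

theorem IsGoodSeq.antitone {a : ℤ → A} (h : IsGoodSeq a) : Antitone a :=
  antitone_int_of_succ_le fun k => (h.good k).le

/-- Goodness speaks of neighbours only; antitonicity replaces `a (j - 1)` by the larger `a i`. -/
theorem IsGoodSeq.odot_of_lt {a : ℤ → A} (h : IsGoodSeq a) {i j : ℤ} (hij : i < j) :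
    a i ⊙ₘ a j = a j := by
  refine (odot_le_right _ _).antisymm ?_
  have h1 := (h.good (j - 1)).2
  rw [sub_add_cancel] at h1
  exact h1.symm.trans_le (odot_le_odot_right (h.antitone (by omega)) _)

theorem mul_prod_eq_self {C ι : Type*} [CommMonoid C] (e : C) (g : ι → C) (s : Finset ι)
    (h : ∀ k ∈ s, e * g k = e) : e * ∏ k ∈ s, g k = e := by
  classical
  induction s using Finset.induction_on with
  | empty => simp
  | insert i s hi ih =>
    rw [Finset.prod_insert hi, ← mul_assoc, h i (Finset.mem_insert_self i s)]
    exact ih fun k hk => h k (Finset.mem_insert_of_mem hk)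

theorem finprod_eq_mul_of_absorb {C ι : Type*} [CommMonoid C] (g : ι → C)
    (hg : (Function.mulSupport g).Finite) {i j : ι} (hij : i ≠ j)
    (h : ∀ k, k ≠ i → k ≠ j → g j * g k = g j) : ∏ᶠ k, g k = g i * g j := by
  classical
  have hs : Function.mulSupport g ⊆ ((insert i (insert j hg.toFinset) : Finset ι) : Set ι) :=
    fun k hk => by simp [Function.mem_mulSupport.1 hk]
  rw [finprod_eq_prod_of_mulSupport_subset g hs,
    ← Finset.mul_prod_erase _ g (a := i) (by simp),
    ← Finset.mul_prod_erase _ g (a := j) (by simp [hij.symm]), mul_prod_eq_self]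
  intro k hk
  simp only [Finset.mem_erase] at hk
  exact h k hk.2.1 hk.1

/-- Factors with `k < n` are `1`. Those with `k > n` are `b (N - k)`, and the one at `k = n + 1`
absorbs all the others, so only `k = n` and `k = n + 1` remain. -/
theorem seqAdd_single_left (n : ℤ) (x : A) {b : ℤ → A} (hb : IsGoodSeq b) (N : ℤ) :
    seqAdd (single n x) b N = (x ⊕ₘ b (N - n)) ⊙ₘ b (N - n - 1) := by
  let _ := odotMonoid A
  refine (finprod_eq_mul_of_absorb (fun k => single n x k ⊕ₘ b (N - k))
    (finite_ne_one ⟨_, isGoodSeq_single n x⟩ ⟨b, hb⟩ N) (i := n) (j := n + 1) (by omega)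
    fun k h1 h2 => ?_).trans ?_
  · rcases lt_or_ge k n with h | h
    · simp only [single_of_lt h, one_oplus]
      exact IsMVM.odot_one _
    · simp only [single_of_gt (show n < n + 1 by omega), single_of_gt (show n < k by omega),
        zero_oplus]
      exact (IsMVM.odot_comm _ _).trans (hb.odot_of_lt (by omega))
  · simp only [single_self, single_of_gt (show n < n + 1 by omega), zero_oplus, ← sub_sub]
    rfl

theorem seqAdd_comm (a b : ℤ → A) : seqAdd a b = seqAdd b a := by
  funext N
  let _ := odotMonoid A
  refine (finprod_comp_equiv (Equiv.subLeft N) (f := fun k => a k ⊕ₘ b (N - k))).symm.trans ?_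
  refine finprod_congr fun k => ?_
  simp only [Equiv.subLeft_apply, sub_sub_cancel]
  exact IsMVM.oplus_comm _ _

theorem seqAdd_eq_one {a b : ℤ → A} {p q : ℤ} (ha : ∀ k < p, a k = 1) (hb : ∀ k < q, b k = 1)
    {N : ℤ} (hN : N < p + q) : seqAdd a b N = 1 := by
  let _ := odotMonoid A
  refine (finprod_congr fun k => ?_).trans finprod_one
  rcases lt_or_ge k p with h | h
  · exact (congrArg (· ⊕ₘ _) (ha k h)).trans (one_oplus _)
  · exact (congrArg (_ ⊕ₘ ·) (hb (N - k) (by omega))).trans (oplus_one _)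

theorem seqAdd_le (a b : GoodSeq A) (N k : ℤ) :
    seqAdd a.seq b.seq N ≤ a.seq k ⊕ₘ b.seq (N - k) := by
  let _ := odotMonoid A
  refine (mul_finprod_cond_ne k (f := fun k => a.seq k ⊕ₘ b.seq (N - k))
    (finite_ne_one a b N)).symm.trans_le ?_
  exact odot_le_left _ _

theorem single_sup_single_of_lt {n m : ℤ} (h : n < m) (x y : A) (k : ℤ) :
    single n x k ⊔ single m y k = single m y k := by
  rcases lt_or_ge k m with h1 | h1
  · rw [single_of_lt h1, sup_eq_right.2 (le_one' _)]
  · rw [single_of_gt (by omega), sup_eq_right.2 (zero_le' _)]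

theorem single_inf_single_of_lt {n m : ℤ} (h : n < m) (x y : A) (k : ℤ) :
    single n x k ⊓ single m y k = single n x k := by
  rcases lt_or_ge k m with h1 | h1
  · rw [single_of_lt h1, inf_eq_left.2 (le_one' _)]
  · rw [single_of_gt (by omega), inf_eq_left.2 (zero_le' _)]

theorem single_sup_single (n : ℤ) (x y : A) (k : ℤ) :
    single n x k ⊔ single n y k = single n (x ⊔ y) k := by
  unfold single
  split_ifs <;> simp

theorem single_inf_single (n : ℤ) (x y : A) (k : ℤ) :
    single n x k ⊓ single n y k = single n (x ⊓ y) k := by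
  unfold single
  split_ifs <;> simp

theorem isGoodSeq_single_sup_single (n m : ℤ) (x y : A) :
    IsGoodSeq fun k => single n x k ⊔ single m y k := by
  rcases lt_trichotomy n m with h | rfl | h
  · simp only [single_sup_single_of_lt h]
    exact isGoodSeq_single m y
  · simp only [single_sup_single]
    exact isGoodSeq_single n _
  · simp only [sup_comm (single n x _), single_sup_single_of_lt h]
    exact isGoodSeq_single n x

theorem isGoodSeq_single_inf_single (n m : ℤ) (x y : A) :
    IsGoodSeq fun k => single n x k ⊓ single m y k := by
  rcases lt_trichotomy n m with h | rfl | h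
  · simp only [single_inf_single_of_lt h]
    exact isGoodSeq_single n x
  · simp only [single_inf_single]
    exact isGoodSeq_single n _
  · simp only [inf_comm (single n x _), single_inf_single_of_lt h]
    exact isGoodSeq_single m y

theorem isGoodSeq_of_pair (n : ℤ) {x y : A} (h : IsGoodPair x y) :
    IsGoodSeq fun k => if k < n then 1 else if k = n then x else if k = n + 1 then y else 0 where
  eventually_one := ⟨n, fun _ hk => if_pos hk⟩
  eventually_zero := ⟨n + 2, fun _ hk => by
    rw [if_neg (by omega), if_neg (by omega), if_neg (by omega)]⟩
  good k := by
    rcases lt_trichotomy k n with h1 | rfl | h1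
    · simp only [if_pos h1]
      exact isGoodPair_one _
    · simpa using h
    · simp only [if_neg (show ¬ k + 1 < n by omega), if_neg (show ¬ k + 1 = n by omega),
        if_neg (show ¬ k + 1 = n + 1 by omega)]
      exact isGoodPair_zero _

theorem seqAdd_single_single (n m : ℤ) (x y : A) :
    seqAdd (single n x) (single m y) = fun k => if k < n + m then 1 else if k = n + m then x ⊕ₘ y
      else if k = n + m + 1 then x ⊙ₘ y else 0 := by
  funext k
  rw [seqAdd_single_left n x (isGoodSeq_single m y)]
  split_ifs with h1 h2 h3
  · rw [single_of_lt (by omega), single_of_lt (by omega), oplus_one, IsMVM.odot_one]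
  · subst h2
    rw [add_sub_cancel_left, single_self, single_of_lt (by omega), IsMVM.odot_one]
  · subst h3
    rw [single_of_gt (by omega), IsMVM.oplus_zero, show n + m + 1 - n - 1 = m by omega, single_self]
  · rw [single_of_gt (k := k - n - 1) (by omega), odot_zero]

theorem isGoodSeq_seqAdd_single_single (n m : ℤ) (x y : A) :
    IsGoodSeq (seqAdd (single n x) (single m y)) := by
  rw [seqAdd_single_single]
  exact isGoodSeq_of_pair _ (isGoodPair_oplus_odot x y)

theorem GoodPairsTrivial.exists_eq_single (hA : GoodPairsTrivial A) (a : GoodSeq A) :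
    ∃ n x, a.seq = single n x := by
  by_cases h : ∃ k, a.seq k ≠ 1
  · obtain ⟨p, hp⟩ := a.isGoodSeq.eventually_one
    -- At the first entry different from `1`, triviality of good pairs forces the next entry to be
    -- `0`.
    obtain ⟨n, hn, hmin⟩ := Int.exists_least_of_bdd
      ⟨p, fun k hk => not_lt.1 fun hlt => hk (hp k hlt)⟩ h
    refine ⟨n, a.seq n, funext fun k => ?_⟩
    rcases lt_trichotomy k n with h1 | rfl | h1
    · rw [single_of_lt h1]
      by_contra h2
      exact (hmin k h2).not_gt h1
    · rw [single_self]
    · rw [single_of_gt h1]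
      have h2 := (hA _ _ (a.isGoodSeq.good n)).resolve_left hn
      exact ((a.isGoodSeq.antitone (Int.add_one_le_iff.2 h1)).trans_eq h2).antisymm (zero_le' _)
  -- A sequence constantly `1` but eventually `0` exists only if `0 = 1`; a step at any such bound
  -- `m` represents it.
  · push Not at h
    obtain ⟨m, hm⟩ := a.isGoodSeq.eventually_zero
    refine ⟨m, 0, funext fun k => ?_⟩
    rw [← stepSeq_eq_single, stepSeq]
    split_ifs with h1
    exacts [h k, hm k (not_lt.1 h1)]

theorem isGoodPair_of_forall_hom {x y : A}
    (h : ∀ (B : Type u) [MVMOps B] [IsMVM B] (f : MVMHom A B),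
      GoodPairsTrivial B → IsGoodPair (f.toFun x) (f.toFun y)) : IsGoodPair x y :=
  ⟨eq_of_forall_hom fun B _ _ f hB => (f.map_oplus _ _).trans (h B f hB).1,
    eq_of_forall_hom fun B _ _ f hB => (f.map_odot _ _).trans (h B f hB).2⟩

variable (A) in
-- The eventual values are found in `A` itself, since their bounds come from the given sequences;
-- only goodness, a pair of equations for each `k`, is tested in quotients.
theorem goodClosed : GoodClosed A where
  sup a b := by
    obtain ⟨p, hp⟩ := a.isGoodSeq.eventually_one
    obtain ⟨q, hq⟩ := a.isGoodSeq.eventually_zero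
    obtain ⟨s, hs⟩ := b.isGoodSeq.eventually_zero
    refine ⟨⟨p, fun k hk => ?_⟩, ⟨max q s, fun k hk => ?_⟩, fun k => ?_⟩
    · rw [hp k hk, sup_eq_left.2 (le_one' _)]
    · rw [hq k (by omega), hs k (by omega), sup_idem]
    · refine isGoodPair_of_forall_hom fun B _ _ f hB => ?_
      obtain ⟨n, x, hx⟩ := hB.exists_eq_single (goodSeqMap f a)
      obtain ⟨m, y, hy⟩ := hB.exists_eq_single (goodSeqMap f b)
      simp only [f.map_sup, ← goodSeqMap_seq, hx, hy]
      exact (isGoodSeq_single_sup_single n m x y).good k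
  inf a b := by
    obtain ⟨p, hp⟩ := a.isGoodSeq.eventually_one
    obtain ⟨q, hq⟩ := a.isGoodSeq.eventually_zero
    obtain ⟨s, hs⟩ := b.isGoodSeq.eventually_one
    refine ⟨⟨min p s, fun k hk => ?_⟩, ⟨q, fun k hk => ?_⟩, fun k => ?_⟩
    · rw [hp k (by omega), hs k (by omega), inf_idem]
    · rw [hq k hk, inf_eq_left.2 (zero_le' _)]
    · refine isGoodPair_of_forall_hom fun B _ _ f hB => ?_
      obtain ⟨n, x, hx⟩ := hB.exists_eq_single (goodSeqMap f a)
      obtain ⟨m, y, hy⟩ := hB.exists_eq_single (goodSeqMap f b)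
      simp only [f.map_inf, ← goodSeqMap_seq, hx, hy]
      exact (isGoodSeq_single_inf_single n m x y).good k
  add a b := by
    obtain ⟨p, hp⟩ := a.isGoodSeq.eventually_one
    obtain ⟨q, hq⟩ := a.isGoodSeq.eventually_zero
    obtain ⟨r, hr⟩ := b.isGoodSeq.eventually_one
    obtain ⟨s, hs⟩ := b.isGoodSeq.eventually_zero
    refine ⟨⟨p + r, fun k hk => seqAdd_eq_one hp hr hk⟩, ⟨q + s, fun k hk => ?_⟩, fun k => ?_⟩
    -- One vanishing factor suffices, and at index `q` both summands are `0`.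
    · refine ((seqAdd_le a b k q).trans_eq ?_).antisymm (zero_le' _)
      rw [hq q le_rfl, hs _ (by omega), IsMVM.oplus_zero]
    · refine isGoodPair_of_forall_hom fun B _ _ f hB => ?_
      obtain ⟨n, x, hx⟩ := hB.exists_eq_single (goodSeqMap f a)
      obtain ⟨m, y, hy⟩ := hB.exists_eq_single (goodSeqMap f b)
      rw [map_seqAdd, map_seqAdd, hx, hy]
      exact (isGoodSeq_seqAdd_single_single n m x y).good k

end Sequences

/-! ### The ℓ-monoid of good sequences -/

section GoodULM

variable {A : Type u} [MVMOps A] [IsMVM A]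

noncomputable instance : ULMOps (GoodSeq A) := goodSeqOps (goodClosed A)

namespace GoodSeq

theorem sup_seq (a b : GoodSeq A) (k : ℤ) : (a ⊔ b).seq k = a.seq k ⊔ b.seq k := rfl
theorem inf_seq (a b : GoodSeq A) (k : ℤ) : (a ⊓ b).seq k = a.seq k ⊓ b.seq k := rfl

/-- The good `ℤ`-sequence that is `1` below `n`, `x` at `n`, and `0` above `n`. -/
def single (n : ℤ) (x : A) : GoodSeq A := ⟨_, isGoodSeq_single n x⟩

theorem single_seq (n : ℤ) (x : A) : (single n x).seq = MVMonoidal.single n x := rfl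

theorem zero_eq : (0 : GoodSeq A) = single 0 0 := GoodSeq.ext (stepSeq_eq_single 0)
theorem one_eq : (1 : GoodSeq A) = single 1 0 := GoodSeq.ext (stepSeq_eq_single 1)
theorem negOne_eq : (ULMOps.negOne : GoodSeq A) = single (-1) 0 :=
  GoodSeq.ext (stepSeq_eq_single (-1))

theorem map_add {B : Type u} [MVMOps B] [IsMVM B] (f : MVMHom A B) (a b : GoodSeq A) :
    goodSeqMap f (a + b) = goodSeqMap f a + goodSeqMap f b :=
  ext' fun n => map_seqAdd f a b n

theorem map_sup {B : Type u} [MVMOps B] [IsMVM B] (f : MVMHom A B) (a b : GoodSeq A) :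
    goodSeqMap f (a ⊔ b) = goodSeqMap f a ⊔ goodSeqMap f b :=
  ext' fun _ => f.map_sup _ _

theorem map_inf {B : Type u} [MVMOps B] [IsMVM B] (f : MVMHom A B) (a b : GoodSeq A) :
    goodSeqMap f (a ⊓ b) = goodSeqMap f a ⊓ goodSeqMap f b :=
  ext' fun _ => f.map_inf _ _

theorem eq_of_forall_hom {a b : GoodSeq A}
    (h : ∀ (B : Type u) [MVMOps B] [IsMVM B] (f : MVMHom A B),
      GoodPairsTrivial B → goodSeqMap f a = goodSeqMap f b) : a = b :=
  ext' fun k => MVMonoidal.eq_of_forall_hom fun B _ _ f hB =>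
    congrArg (fun c => GoodSeq.seq c k) (h B f hB)

theorem exists_eq_single (hA : GoodPairsTrivial A) (a : GoodSeq A) : ∃ n x, a = single n x := by
  obtain ⟨n, x, h⟩ := hA.exists_eq_single a
  exact ⟨n, x, GoodSeq.ext h⟩

protected theorem add_comm (a b : GoodSeq A) : a + b = b + a := GoodSeq.ext (seqAdd_comm _ _)

theorem single_add_seq (n : ℤ) (x : A) (b : GoodSeq A) (k : ℤ) :
    (single n x + b).seq k = (x ⊕ₘ b.seq (k - n)) ⊙ₘ b.seq (k - n - 1) :=
  seqAdd_single_left n x b.isGoodSeq k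

theorem single_add_single_seq (n m : ℤ) (x y : A) :
    (single n x + single m y).seq = fun k => if k < n + m then 1 else if k = n + m then x ⊕ₘ y
      else if k = n + m + 1 then x ⊙ₘ y else 0 :=
  seqAdd_single_single n m x y

theorem single_zero_add_seq (n : ℤ) (b : GoodSeq A) (k : ℤ) :
    (single n 0 + b).seq k = b.seq (k - n) := by
  rw [single_add_seq, zero_oplus, IsMVM.odot_comm]
  exact b.isGoodSeq.odot_of_lt (by omega)

theorem single_zero_add_single (n m : ℤ) (x : A) : single n 0 + single m x = single (n + m) x :=
  ext' fun k => by
    rw [single_zero_add_seq, single_seq, single_seq, MVMonoidal.single, MVMonoidal.single]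
    congr 1
    · simp [sub_lt_iff_lt_add']
    · simp [sub_eq_iff_eq_add']

/-- From position `n + m + l` on, the entries are the triple `⊕`, the ternary term, the triple `⊙`,
then zeros. Only the ternary term needs more than associativity, namely `oplus_odot_cycle`. -/
theorem single_add_assoc (n m l : ℤ) (x y z : A) :
    (single n x + single m y) + single l z = single n x + (single m y + single l z) :=
  ext' fun k => by
    rw [GoodSeq.add_comm, single_add_seq l z, single_add_single_seq, single_add_seq n x,
      single_add_single_seq]
    rcases lt_trichotomy k (n + m + l) with h | h | h
    · simp (disch := omega) only [if_pos, oplus_one, IsMVM.odot_one]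
    · simp (disch := omega) only [if_pos, if_neg, IsMVM.odot_one]
      rw [IsMVM.oplus_comm, IsMVM.oplus_assoc]
    · rcases lt_trichotomy k (n + m + l + 1) with h1 | h1 | h1
      · omega
      · simp (disch := omega) only [if_pos, if_neg]
        rw [IsMVM.odot_comm, IsMVM.oplus_comm z, oplus_odot_cycle, IsMVM.odot_comm,
          IsMVM.oplus_comm x]
      · rcases lt_trichotomy k (n + m + l + 2) with h2 | h2 | h2
        · omega
        · simp (disch := omega) only [if_pos, if_neg, IsMVM.oplus_zero]
          rw [IsMVM.odot_comm, IsMVM.odot_assoc]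
        · simp (disch := omega) only [if_neg, odot_zero]

protected theorem add_assoc (a b c : GoodSeq A) : (a + b) + c = a + (b + c) :=
  eq_of_forall_hom fun B _ _ f hB => by
    obtain ⟨n, x, hx⟩ := exists_eq_single hB (goodSeqMap f a)
    obtain ⟨m, y, hy⟩ := exists_eq_single hB (goodSeqMap f b)
    obtain ⟨l, z, hz⟩ := exists_eq_single hB (goodSeqMap f c)
    simp only [map_add, hx, hy, hz, single_add_assoc]

theorem single_sup_of_lt {n m : ℤ} (h : n < m) (x y : A) :
    single n x ⊔ single m y = single m y := ext' (single_sup_single_of_lt h x y)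

theorem single_inf_of_lt {n m : ℤ} (h : n < m) (x y : A) :
    single n x ⊓ single m y = single n x := ext' (single_inf_single_of_lt h x y)

theorem single_sup_single (n : ℤ) (x y : A) :
    single n x ⊔ single n y = single n (x ⊔ y) := ext' (MVMonoidal.single_sup_single n x y)

theorem single_inf_single (n : ℤ) (x y : A) :
    single n x ⊓ single n y = single n (x ⊓ y) := ext' (MVMonoidal.single_inf_single n x y)

protected theorem sup_comm (a b : GoodSeq A) : a ⊔ b = b ⊔ a := ext' fun _ => sup_comm _ _
protected theorem inf_comm (a b : GoodSeq A) : a ⊓ b = b ⊓ a := ext' fun _ => inf_comm _ _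

theorem single_add_seq_mono (n : ℤ) (x : A) {a b : GoodSeq A} (h : ∀ k, a.seq k ≤ b.seq k) (k : ℤ) :
    (single n x + a).seq k ≤ (single n x + b).seq k := by
  rw [single_add_seq, single_add_seq]
  exact odot_le_odot (oplus_le_oplus_left (h _) x) (h _)

theorem single_add_sup_of_le (n : ℤ) (x : A) {a b : GoodSeq A} (h : a ⊔ b = b) :
    single n x + (a ⊔ b) = (single n x + a) ⊔ (single n x + b) :=
  ext' fun k => by
    have hab (k) : a.seq k ≤ b.seq k := sup_eq_right.1 (congrArg (fun c => GoodSeq.seq c k) h)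
    rw [h, sup_seq, sup_eq_right.2 (single_add_seq_mono n x hab k)]

theorem single_add_inf_of_le (n : ℤ) (x : A) {a b : GoodSeq A} (h : a ⊓ b = a) :
    single n x + (a ⊓ b) = (single n x + a) ⊓ (single n x + b) :=
  ext' fun k => by
    have hab (k) : a.seq k ≤ b.seq k := inf_eq_left.1 (congrArg (fun c => GoodSeq.seq c k) h)
    rw [h, inf_seq, inf_eq_left.2 (single_add_seq_mono n x hab k)]

/-- One-entry sequences at different positions are comparable, so monotonicity of addition suffices;
at equal positions the claim is distributivity of `⊕` and `⊙`. -/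
protected theorem add_sup (a b c : GoodSeq A) : a + (b ⊔ c) = (a + b) ⊔ (a + c) :=
  eq_of_forall_hom fun B _ _ f hB => by
    obtain ⟨n, x, hx⟩ := exists_eq_single hB (goodSeqMap f a)
    obtain ⟨m, y, hy⟩ := exists_eq_single hB (goodSeqMap f b)
    obtain ⟨l, z, hz⟩ := exists_eq_single hB (goodSeqMap f c)
    simp only [map_add, map_sup, hx, hy, hz]
    rcases lt_trichotomy m l with h | rfl | h
    · exact single_add_sup_of_le n x (single_sup_of_lt h y z)
    · refine ext' fun k => ?_
      rw [single_sup_single, sup_seq, single_add_single_seq, single_add_single_seq,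
        single_add_single_seq]
      dsimp only
      split_ifs <;> simp [IsMVM.oplus_sup, IsMVM.odot_sup]
    · rw [GoodSeq.sup_comm, GoodSeq.sup_comm (single n x + _)]
      exact single_add_sup_of_le n x (single_sup_of_lt h z y)

protected theorem add_inf (a b c : GoodSeq A) : a + (b ⊓ c) = (a + b) ⊓ (a + c) :=
  eq_of_forall_hom fun B _ _ f hB => by
    obtain ⟨n, x, hx⟩ := exists_eq_single hB (goodSeqMap f a)
    obtain ⟨m, y, hy⟩ := exists_eq_single hB (goodSeqMap f b)
    obtain ⟨l, z, hz⟩ := exists_eq_single hB (goodSeqMap f c)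
    simp only [map_add, map_inf, hx, hy, hz]
    rcases lt_trichotomy m l with h | rfl | h
    · exact single_add_inf_of_le n x (single_inf_of_lt h y z)
    · refine ext' fun k => ?_
      rw [single_inf_single, inf_seq, single_add_single_seq, single_add_single_seq,
        single_add_single_seq]
      dsimp only
      split_ifs <;> simp [IsMVM.oplus_inf, IsMVM.odot_inf]
    · rw [GoodSeq.inf_comm, GoodSeq.inf_comm (single n x + _)]
      exact single_add_inf_of_le n x (single_inf_of_lt h z y)

protected theorem zero_add (a : GoodSeq A) : 0 + a = a :=
  ext' fun k => by rw [zero_eq, single_zero_add_seq, sub_zero]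

theorem nsmulRec_one (n : ℕ) : nsmulRec n (1 : GoodSeq A) = single n 0 := by
  induction n with
  | zero => exact zero_eq
  | succ n ih => rw [nsmulRec, ih, one_eq, single_zero_add_single]; rfl

theorem nsmulRec_negOne (n : ℕ) :
    nsmulRec n (ULMOps.negOne : GoodSeq A) = single (-n) 0 := by
  induction n with
  | zero => exact zero_eq
  | succ n ih =>
    rw [nsmulRec, ih, negOne_eq, single_zero_add_single, Nat.cast_succ, neg_add]

theorem single_sup_eq_right {n : ℤ} {a : GoodSeq A} (h : ∀ k < n, a.seq k = 1) :
    single n 0 ⊔ a = a :=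
  ext' fun k => by
    rw [sup_seq, single_seq, ← stepSeq_eq_single, stepSeq]
    split_ifs with hk
    · rw [h k hk, sup_idem]
    · exact sup_eq_right.2 (zero_le' _)

theorem sup_single_eq_right {n : ℤ} {a : GoodSeq A} (h : ∀ k ≥ n, a.seq k = 0) :
    a ⊔ single n 0 = single n 0 :=
  ext' fun k => by
    rw [sup_seq, single_seq, ← stepSeq_eq_single, stepSeq]
    split_ifs with hk
    · exact sup_eq_right.2 (le_one' _)
    · rw [h k (not_lt.1 hk), sup_idem]

instance : IsULM (GoodSeq A) where
  sup_comm := GoodSeq.sup_comm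
  inf_comm := GoodSeq.inf_comm
  sup_assoc _ _ _ := ext' fun _ => sup_assoc _ _ _
  inf_assoc _ _ _ := ext' fun _ => inf_assoc _ _ _
  sup_inf_self _ _ := ext' fun _ => sup_inf_self
  inf_sup_self _ _ := ext' fun _ => inf_sup_self
  inf_sup_left _ _ _ := ext' fun _ => inf_sup_left _ _ _
  add_assoc := GoodSeq.add_assoc
  add_comm := GoodSeq.add_comm
  zero_add := GoodSeq.zero_add
  add_zero a := (GoodSeq.add_comm _ _).trans (GoodSeq.zero_add a)
  sup_add a b c := by
    rw [GoodSeq.add_comm, GoodSeq.add_sup, GoodSeq.add_comm c, GoodSeq.add_comm c]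
  add_sup := GoodSeq.add_sup
  inf_add a b c := by
    rw [GoodSeq.add_comm, GoodSeq.add_inf, GoodSeq.add_comm c, GoodSeq.add_comm c]
  add_inf := GoodSeq.add_inf
  negOne_add_one := by rw [negOne_eq, one_eq, single_zero_add_single, zero_eq]; rfl
  one_add_negOne := by rw [negOne_eq, one_eq, single_zero_add_single, zero_eq]; rfl
  negOne_le_zero := by rw [negOne_eq, zero_eq, single_sup_of_lt (by omega)]
  zero_le_one := by rw [one_eq, zero_eq, single_sup_of_lt (by omega)]
  exists_bound a := by
    obtain ⟨p, hp⟩ := a.isGoodSeq.eventually_one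
    obtain ⟨q, hq⟩ := a.isGoodSeq.eventually_zero
    -- Large enough for both `-p` and `q`; the extra `1` makes it positive.
    refine ⟨p.natAbs + q.natAbs + 1, by omega, ?_, ?_⟩
    · rw [nsmulRec_negOne]
      exact single_sup_eq_right fun k hk => hp k (by omega)
    · rw [nsmulRec_one]
      exact sup_single_eq_right fun k hk => hq k (by omega)

end GoodSeq

end GoodULM

/-! ### Decomposing an element into its truncations -/

section Truncation

variable {M : Type u} [ULMOps M] [IsULM M]

/-- The constant `1`, an invertible element with inverse `-1`. -/
def oneUnit (M : Type u) [ULMOps M] [IsULM M] : AddUnits M :=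
  ⟨1, ULMOps.negOne, IsULM.one_add_negOne, IsULM.negOne_add_one⟩

/-- The multiple `n1` of the constant `1`, for an integer `n`. -/
def intConst (M : Type u) [ULMOps M] [IsULM M] (n : ℤ) : M := ((n • oneUnit M : AddUnits M) : M)

theorem intConst_zero : intConst M 0 = 0 := by rw [intConst, zero_smul, AddUnits.val_zero]

theorem intConst_add (n m : ℤ) : intConst M (n + m) = intConst M n + intConst M m := by
  rw [intConst, add_smul, AddUnits.val_add]
  rfl

theorem intConst_one : intConst M 1 = 1 := by
  rw [intConst, one_smul]
  rfl

theorem intConst_neg_one : intConst M (-1) = ULMOps.negOne := by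
  rw [intConst, neg_smul, one_smul]
  rfl

theorem intConst_add_neg (n : ℤ) : intConst M n + intConst M (-n) = 0 := by
  rw [← intConst_add, add_neg_cancel, intConst_zero]

/-- Addition in `M` need not be cancellative, but integer constants are invertible; truncations are
compared after a shift. -/
theorem add_intConst_cancel {x y : M} {n : ℤ} (h : x + intConst M n = y + intConst M n) :
    x = y := by
  rw [← add_zero x, ← add_zero y, ← intConst_add_neg n, ← add_assoc, ← add_assoc, h]

theorem intConst_natCast (n : ℕ) : intConst M n = nsmulRec n 1 := by
  induction n with
  | zero => exact intConst_zero
  | succ n ih => rw [Nat.cast_succ, intConst_add, ih, intConst_one, nsmulRec]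

theorem intConst_neg_natCast (n : ℕ) : intConst M (-n) = nsmulRec n ULMOps.negOne := by
  induction n with
  | zero => exact intConst_zero
  | succ n ih => rw [Nat.cast_succ, neg_add, intConst_add, ih, intConst_neg_one, nsmulRec]

theorem intConst_mono : Monotone (intConst M) := by
  refine monotone_int_of_le_succ fun n => ?_
  rw [intConst_add, intConst_one]
  exact le_add_of_nonneg_right ulm_zero_le_one

theorem map_intConst {N : Type u} [ULMOps N] [IsULM N] (f : ULMHom M N) (n : ℤ) :
    f.toFun (intConst M n) = intConst N n := by
  induction n using Int.induction_on with
  | zero => rw [intConst_zero, intConst_zero, f.map_zero]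
  | succ n ih => rw [intConst_add, intConst_add, f.map_add, ih, intConst_one, intConst_one, f.map_one]
  | pred n ih =>
    rw [sub_eq_add_neg, intConst_add, intConst_add, f.map_add, ih, intConst_neg_one,
      intConst_neg_one, f.map_negOne]

theorem exists_intConst_le (x : M) : ∃ n : ℕ, intConst M (-n) ≤ x ∧ x ≤ intConst M n := by
  obtain ⟨n, -, h1, h2⟩ := IsULM.exists_bound x
  rw [← intConst_neg_natCast] at h1
  rw [← intConst_natCast] at h2
  exact ⟨n, sup_eq_right.1 h1, sup_eq_right.1 h2⟩

theorem inf_add_sup_eq (p q : M) : (p ⊓ q) + (p ⊔ q) = p + q := by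
  apply le_antisymm
  · rw [IsULM.add_sup]
    exact sup_le ((add_le_add_left inf_le_right _).trans_eq (add_comm _ _))
      (add_le_add_left inf_le_left _)
  · rw [IsULM.inf_add]
    exact le_inf (add_le_add_right le_sup_right _)
      ((add_comm _ _).trans_le (add_le_add_right le_sup_left _))

/-- The two adjacent clamps are the meet and the join of the long clamp with `b`. -/
theorem clamp_add_clamp (w : M) {a b c : M} (hab : a ≤ b) (hbc : b ≤ c) :
    ((w ⊔ a) ⊓ b) + ((w ⊔ b) ⊓ c) = ((w ⊔ a) ⊓ c) + b := by
  rw [← inf_add_sup_eq ((w ⊔ a) ⊓ c) b, inf_assoc, inf_eq_right.2 hbc, sup_inf_right, sup_assoc,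
    sup_eq_right.2 hab, sup_eq_left.2 hbc]

/-- The element `((x - n) ∨ 0) ∧ 1` of the unit interval. -/
def trunc (x : M) (n : ℤ) : UnitInterval M :=
  ⟨((x + intConst M (-n)) ⊔ 0) ⊓ 1, le_inf le_sup_right ulm_zero_le_one, inf_le_right⟩

theorem trunc_val (x : M) (n : ℤ) : (trunc x n).val = ((x + intConst M (-n)) ⊔ 0) ⊓ 1 := rfl

theorem trunc_val_add (x : M) (n : ℤ) :
    (trunc x n).val + intConst M n = (x ⊔ intConst M n) ⊓ intConst M (n + 1) := by
  rw [trunc_val, IsULM.inf_add, IsULM.sup_add, add_assoc, ← intConst_add, neg_add_cancel,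
    intConst_zero, add_zero, zero_add, intConst_add, intConst_one, add_comm 1]

/-- Widening the window by one unit adds exactly one truncation. Iterating rebuilds `x` from its
truncations. -/
theorem clamp_succ (x : M) {a n : ℤ} (h : a ≤ n) :
    (x ⊔ intConst M a) ⊓ intConst M (n + 1) =
      (trunc x n).val + ((x ⊔ intConst M a) ⊓ intConst M n) := by
  apply add_intConst_cancel (n := n)
  rw [add_right_comm, trunc_val_add, add_comm (_ ⊓ _) (_ ⊓ _),
    clamp_add_clamp x (intConst_mono h) (intConst_mono (by omega))]

theorem trunc_intConst_add (x : M) (m n : ℤ) : trunc (intConst M m + x) n = trunc x (n - m) :=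
  UnitInterval.ext <| by
    rw [trunc_val, trunc_val, add_comm _ x, add_assoc, ← intConst_add, neg_sub, sub_eq_add_neg]

theorem trunc_eq_trunc_zero (x : M) (n : ℤ) : trunc x n = trunc (intConst M (-n) + x) 0 := by
  rw [trunc_intConst_add, zero_sub, neg_neg]

theorem trunc_eq_one {x : M} {n : ℤ} (h : intConst M (n + 1) ≤ x) : trunc x n = 1 :=
  UnitInterval.ext <| by
    have h1 := add_le_add_left h (intConst M (-n))
    rw [← intConst_add, add_neg_cancel_comm, intConst_one] at h1
    rw [trunc_val, UnitInterval.val_one, inf_eq_right]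
    exact h1.trans le_sup_left

theorem trunc_eq_zero {x : M} {n : ℤ} (h : x ≤ intConst M n) : trunc x n = 0 :=
  UnitInterval.ext <| by
    have h1 := add_le_add_left h (intConst M (-n))
    rw [intConst_add_neg] at h1
    rw [trunc_val, UnitInterval.val_zero, sup_eq_right.2 h1, inf_eq_left.2 ulm_zero_le_one]

theorem trunc_intConst (m : ℤ) : trunc (intConst M m) = single m 0 := by
  funext n
  rw [← stepSeq_eq_single, stepSeq]
  split_ifs with h
  · exact trunc_eq_one (intConst_mono (by omega))
  · exact trunc_eq_zero (intConst_mono (by omega))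

theorem trunc_zero_val (x : M) : (trunc x 0).val = (x ⊔ 0) ⊓ 1 := by
  rw [trunc_val, neg_zero, intConst_zero, add_zero]

theorem trunc_one_val (x : M) : (trunc x 1).val = ((x + ULMOps.negOne) ⊔ 0) ⊓ 1 := by
  rw [trunc_val, intConst_neg_one]

theorem one_le_two : (1 : M) ≤ 1 + 1 := le_add_of_nonneg_right ulm_zero_le_one

theorem trunc_zero_add_trunc_one (x : M) :
    (trunc x 0).val + (trunc x 1).val = (x ⊔ 0) ⊓ (1 + 1) := by
  apply add_intConst_cancel (n := 1)
  rw [add_assoc, trunc_val_add, trunc_zero_val, intConst_add, intConst_one,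
    clamp_add_clamp x ulm_zero_le_one one_le_two]

/-- After shifting to `n = 0`, the two truncations add up to the clamp of `x` to `[0, 2]`, from
which `⊕` and `⊙` recover the lower and the upper unit. -/
theorem isGoodPair_trunc (x : M) (n : ℤ) : IsGoodPair (trunc x n) (trunc x (n + 1)) := by
  rw [trunc_eq_trunc_zero x n, show trunc x (n + 1) = trunc (intConst M (-n) + x) 1 by
    rw [trunc_intConst_add, sub_neg_eq_add, add_comm]]
  generalize intConst M (-n) + x = w
  constructor <;> apply UnitInterval.ext
  · rw [UnitInterval.val_oplus, trunc_zero_add_trunc_one, inf_assoc, inf_eq_right.2 one_le_two,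
      trunc_zero_val]
  · rw [UnitInterval.val_odot, trunc_zero_add_trunc_one, IsULM.inf_add, IsULM.sup_add, zero_add,
      one_cancel, trunc_one_val, sup_inf_right, sup_assoc, sup_eq_left.2 ulm_zero_le_one,
      IsULM.negOne_le_zero]

/-- The good `ℤ`-sequence `n ↦ ((x - n) ∨ 0) ∧ 1`. -/
def truncSeq (x : M) : GoodSeq (UnitInterval M) where
  seq := trunc x
  isGoodSeq := by
    obtain ⟨n, h1, h2⟩ := exists_intConst_le x
    exact ⟨⟨-n, fun k hk => trunc_eq_one ((intConst_mono (by omega)).trans h1)⟩,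
      ⟨n, fun k hk => trunc_eq_zero (h2.trans (intConst_mono hk))⟩, isGoodPair_trunc x⟩

theorem truncSeq_seq (x : M) : (truncSeq x).seq = trunc x := rfl

/-- Every element is a sum of an integer constant and finitely many elements of the unit
interval. -/
theorem induction_on_unitInterval {p : M → Prop} (hc : ∀ n, p (intConst M n))
    (hs : ∀ (s : UnitInterval M) (y : M), p y → p (s.val + y)) (x : M) : p x := by
  have key (a : ℤ) (k : ℕ) : p ((x ⊔ intConst M a) ⊓ intConst M (a + k)) := by
    induction k with
    | zero =>
      rw [Nat.cast_zero, add_zero, inf_eq_right.2 le_sup_right]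
      exact hc a
    | succ k ih =>
      rw [Nat.cast_succ, ← add_assoc, clamp_succ x (by omega)]
      exact hs _ _ ih
  -- On a window `[-n, n]` containing `x` the clamp is `x` itself.
  obtain ⟨n, h1, h2⟩ := exists_intConst_le x
  have h := key (-n) (n + n)
  rwa [Nat.cast_add, neg_add_cancel_left, sup_eq_left.2 h1, inf_eq_left.2 h2] at h

theorem truncSeq_injective : Function.Injective (truncSeq (M := M)) := by
  intro x y hxy
  have ht (n : ℤ) : trunc x n = trunc y n := congrArg (fun a => GoodSeq.seq a n) hxy
  have key (a : ℤ) (k : ℕ) : (x ⊔ intConst M a) ⊓ intConst M (a + k) =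
      (y ⊔ intConst M a) ⊓ intConst M (a + k) := by
    induction k with
    | zero => rw [Nat.cast_zero, add_zero, inf_eq_right.2 le_sup_right, inf_eq_right.2 le_sup_right]
    | succ k ih =>
      rw [Nat.cast_succ, ← add_assoc, clamp_succ x (by omega), clamp_succ y (by omega), ih, ht]
  obtain ⟨n, h1, h2⟩ := exists_intConst_le x
  obtain ⟨m, h3, h4⟩ := exists_intConst_le y
  have hn : ((n ⊔ m : ℕ) : ℤ) = (n : ℤ) ⊔ m := Nat.cast_max n m
  have h := key (-(n ⊔ m : ℕ)) ((n ⊔ m) + (n ⊔ m))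
  rwa [Nat.cast_add, neg_add_cancel_left,
    sup_eq_left.2 ((intConst_mono (by omega)).trans h1),
    inf_eq_left.2 (h2.trans (intConst_mono (by omega))),
    sup_eq_left.2 ((intConst_mono (by omega)).trans h3),
    inf_eq_left.2 (h4.trans (intConst_mono (by omega)))] at h

/-- The key case of additivity: the right side is the entry at `0` of the sum of the one-entry
sequence of `s` and the truncations of `y`. -/
theorem trunc_unitInterval_add_zero (s : UnitInterval M) (y : M) :
    trunc (s.val + y) 0 = (s ⊕ₘ trunc y 0) ⊙ₘ trunc y (-1) := by
  apply UnitInterval.ext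
  have h1 : (trunc y (-1)).val = ((y + 1) ⊔ 0) ⊓ 1 := by rw [trunc_val, neg_neg, intConst_one]
  -- Two adjacent truncations glue to a clamp of `y + 1` to `[0, 2]`, that is, of `y` to `[-1, 1]`.
  have h2 : (trunc y 0).val + (trunc y (-1)).val + ULMOps.negOne =
      (y ⊔ ULMOps.negOne) ⊓ 1 := by
    have h3 := trunc_zero_add_trunc_one (intConst M 1 + y)
    rw [trunc_intConst_add, trunc_intConst_add, zero_sub, sub_self, intConst_one, add_comm 1 y] at h3
    rw [add_comm (trunc y 0).val, h3, IsULM.inf_add, IsULM.sup_add, one_cancel, one_cancel, zero_add]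
  rw [UnitInterval.oplus_odot, add_assoc s.val, add_assoc s.val, h2, h1, trunc_zero_val,
    IsULM.add_inf, IsULM.add_sup]
  have hs1 : s.val + ULMOps.negOne ≤ 0 :=
    (add_le_add_left s.le_one _).trans_eq IsULM.one_add_negOne
  have hs2 : (1 : M) ≤ s.val + 1 := le_add_of_nonneg_left s.zero_le
  have hs3 : s.val + y ≤ y + 1 := (add_comm _ _).trans_le (add_le_add_right s.le_one y)
  rw [sup_inf_right, sup_inf_right, sup_inf_right, sup_assoc, sup_eq_right.2 hs1,
    sup_eq_left.2 (s.zero_le.trans (le_add_of_nonneg_right ulm_zero_le_one)),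
    sup_assoc, sup_idem, sup_eq_left.2 (ulm_zero_le_one (M := M)), inf_assoc,
    inf_left_comm]
  -- The surplus meetands `s + 1` and `(y + 1) ∨ 0` lie above `1` and above `(s + y) ∨ 0`.
  exact le_antisymm (le_inf (inf_le_right.trans hs2) (le_inf inf_le_left
      (le_inf (inf_le_left.trans (sup_le_sup_right hs3 0)) inf_le_right)))
    (le_inf (inf_le_right.trans inf_le_left) (inf_le_right.trans (inf_le_right.trans inf_le_right)))

theorem truncSeq_unitInterval_add (s : UnitInterval M) (y : M) :
    truncSeq (s.val + y) = GoodSeq.single 0 s + truncSeq y :=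
  GoodSeq.ext' fun k => by
    rw [GoodSeq.single_add_seq, truncSeq_seq, truncSeq_seq, sub_zero, trunc_eq_trunc_zero,
      add_left_comm, trunc_unitInterval_add_zero, trunc_intConst_add, trunc_intConst_add,
      show 0 - -k = k by omega, show -1 - -k = k - 1 by omega]

theorem truncSeq_intConst (m : ℤ) : truncSeq (intConst M m) = GoodSeq.single m 0 :=
  GoodSeq.ext (trunc_intConst m)

theorem truncSeq_zero : truncSeq (0 : M) = 0 := by
  rw [← intConst_zero, truncSeq_intConst, GoodSeq.zero_eq]

/-- Decomposing `x`: integer constants only shift indices, and unit-interval summands are handled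
one at a time. -/
theorem truncSeq_add (x y : M) : truncSeq (x + y) = truncSeq x + truncSeq y := by
  induction x using induction_on_unitInterval with
  | hc n =>
    refine GoodSeq.ext' fun k => ?_
    rw [truncSeq_intConst, GoodSeq.single_zero_add_seq, truncSeq_seq, truncSeq_seq,
      trunc_intConst_add]
  | hs s x ih => rw [add_assoc, truncSeq_unitInterval_add, ih, truncSeq_unitInterval_add, add_assoc]

/-- The homomorphism from `M` to the algebra of good `ℤ`-sequences in its unit interval. -/
def truncHom (M : Type u) [ULMOps M] [IsULM M] : ULMHom M (GoodSeq (UnitInterval M)) where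
  toFun := truncSeq
  map_add := truncSeq_add
  map_sup x y := GoodSeq.ext' fun k => UnitInterval.ext <| by
    simp only [truncSeq_seq, GoodSeq.sup_seq, UnitInterval.val_sup, trunc_val, IsULM.sup_add,
      ← inf_sup_right, sup_sup_distrib_right _ _ (0 : M)]
  map_inf x y := GoodSeq.ext' fun k => UnitInterval.ext <| by
    simp only [truncSeq_seq, GoodSeq.inf_seq, UnitInterval.val_inf, trunc_val, IsULM.inf_add,
      sup_inf_right, inf_inf_distrib_right _ _ (1 : M)]
  map_zero := truncSeq_zero
  map_one := by rw [← intConst_one, truncSeq_intConst, GoodSeq.one_eq]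
  map_negOne := by rw [← intConst_neg_one, truncSeq_intConst, GoodSeq.negOne_eq]

end Truncation

/-! ### The two comparison maps are bijective -/

section GoodUnitInterval

variable {A : Type u} [MVMOps A] [IsMVM A]

theorem GoodSeq.seq_mono {a b : GoodSeq A} (h : a ≤ b) (k : ℤ) : a.seq k ≤ b.seq k :=
  sup_eq_right.1 (congrArg (fun c => GoodSeq.seq c k) (sup_eq_right.2 h))

theorem GoodSeq.zero_le_single (x : A) : 0 ≤ GoodSeq.single 0 x := by
  rw [← sup_eq_right, GoodSeq.zero_eq, GoodSeq.single_sup_single, sup_eq_right.2 (zero_le' x)]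

theorem GoodSeq.single_le_one (x : A) : GoodSeq.single 0 x ≤ 1 := by
  rw [← sup_eq_right, GoodSeq.one_eq, GoodSeq.single_sup_of_lt (by omega)]

/-- The bound `0 ≤ s` forces ones below `0`, and `s ≤ 1` forces zeros above `0`. -/
theorem UnitInterval.goodSeq_eq_single (s : UnitInterval (GoodSeq A)) :
    s.val = GoodSeq.single 0 (s.val.seq 0) :=
  GoodSeq.ext' fun k => by
    have h0 := GoodSeq.seq_mono s.zero_le k
    have h1 := GoodSeq.seq_mono s.le_one k
    rw [GoodSeq.zero_eq, GoodSeq.single_seq] at h0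
    rw [GoodSeq.one_eq, GoodSeq.single_seq] at h1
    rw [GoodSeq.single_seq]
    rcases lt_trichotomy k 0 with h | rfl | h
    · rw [single_of_lt h] at h0 ⊢
      exact (le_one' _).antisymm h0
    · rw [single_self]
    · rw [← stepSeq_eq_single, stepSeq, if_neg (by omega)] at h1
      rw [single_of_gt h]
      exact h1.antisymm (zero_le' _)

variable (A) in
/-- The homomorphism that evaluates a good `ℤ`-sequence between `0` and `1` at `0`. -/
def evalHom : MVMHom (UnitInterval (GoodSeq A)) A where
  toFun s := s.val.seq 0
  map_oplus s t := by
    rw [UnitInterval.val_oplus, GoodSeq.inf_seq, GoodSeq.one_eq, GoodSeq.single_seq,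
      single_of_lt one_pos, inf_eq_left.2 (le_one' _), s.goodSeq_eq_single, t.goodSeq_eq_single,
      GoodSeq.single_add_single_seq]
    simp [GoodSeq.single_seq, single_self]
  map_odot s t := by
    -- Adding `-1` shifts indices, so the entry of `s + t - 1` at `0` is that of `s + t` at `1`, a
    -- `⊙`.
    rw [UnitInterval.val_odot, GoodSeq.sup_seq, GoodSeq.zero_eq, GoodSeq.single_seq,
      single_self, sup_eq_left.2 (zero_le' _), add_comm, GoodSeq.negOne_eq,
      GoodSeq.single_zero_add_seq, s.goodSeq_eq_single, t.goodSeq_eq_single,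
      GoodSeq.single_add_single_seq]
    simp [GoodSeq.single_seq, single_self]
  map_sup _ _ := rfl
  map_inf _ _ := rfl
  map_zero := by rw [UnitInterval.val_zero, GoodSeq.zero_eq, GoodSeq.single_seq, single_self]
  map_one := by rw [UnitInterval.val_one, GoodSeq.one_eq, GoodSeq.single_seq, single_of_lt one_pos]

theorem evalHom_bijective : Function.Bijective (evalHom A).toFun := by
  refine ⟨fun s t h => UnitInterval.ext ?_, fun x => ⟨⟨GoodSeq.single 0 x,
    GoodSeq.zero_le_single x, GoodSeq.single_le_one x⟩, single_self 0 x⟩⟩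
  rw [s.goodSeq_eq_single, t.goodSeq_eq_single]
  exact congrArg _ h

theorem truncSeq_bijective {M : Type u} [ULMOps M] [IsULM M] :
    Function.Bijective (truncSeq (M := M)) := by
  refine ⟨truncSeq_injective, fun a => ?_⟩
  -- The decomposition is now used in the algebra of good sequences itself, whose unit interval
  -- consists of one-entry sequences at `0`.
  induction a using induction_on_unitInterval with
  | hc n => exact ⟨intConst M n, map_intConst (truncHom M) n⟩
  | hs s a ih =>
    obtain ⟨y, rfl⟩ := ih
    exact ⟨(s.val.seq 0).val + y, by rw [truncSeq_unitInterval_add, ← s.goodSeq_eq_single]⟩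

end GoodUnitInterval

/-! ### Natural isomorphisms and the equivalence -/

section Isomorphisms

/-- A bijective homomorphism is an isomorphism. -/
noncomputable def ULMHom.iso {M N : ULM.{u}} (f : M ⟶ N)
    (hf : Function.Bijective (ULMHom.toFun f)) : M ≅ N :=
  let e := Equiv.ofBijective _ hf
  have hr (y : N) : ULMHom.toFun f (e.symm y) = y := e.apply_symm_apply y
  have hl (x : M) : e.symm (ULMHom.toFun f x) = x := e.symm_apply_apply x
  { hom := f
    inv :=
      { toFun := e.symm
        map_add := fun x y => hf.1 <| by rw [ULMHom.map_add, hr, hr, hr]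
        map_sup := fun x y => hf.1 <| by rw [ULMHom.map_sup, hr, hr, hr]
        map_inf := fun x y => hf.1 <| by rw [ULMHom.map_inf, hr, hr, hr]
        map_zero := hf.1 <| by rw [ULMHom.map_zero, hr]
        map_one := hf.1 <| by rw [ULMHom.map_one, hr]
        map_negOne := hf.1 <| by rw [ULMHom.map_negOne, hr] }
    hom_inv_id := ULMHom.ext (funext hl)
    inv_hom_id := ULMHom.ext (funext hr) }

/-- A bijective homomorphism is an isomorphism. -/
noncomputable def MVMHom.iso {A B : MVM.{u}} (f : A ⟶ B)
    (hf : Function.Bijective (MVMHom.toFun f)) : A ≅ B :=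
  let e := Equiv.ofBijective _ hf
  have hr (y : B) : MVMHom.toFun f (e.symm y) = y := e.apply_symm_apply y
  have hl (x : A) : e.symm (MVMHom.toFun f x) = x := e.symm_apply_apply x
  { hom := f
    inv :=
      { toFun := e.symm
        map_oplus := fun x y => hf.1 <| by rw [MVMHom.map_oplus, hr, hr, hr]
        map_odot := fun x y => hf.1 <| by rw [MVMHom.map_odot, hr, hr, hr]
        map_sup := fun x y => hf.1 <| by rw [MVMHom.map_sup, hr, hr, hr]
        map_inf := fun x y => hf.1 <| by rw [MVMHom.map_inf, hr, hr, hr]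
        map_zero := hf.1 <| by rw [MVMHom.map_zero, hr]
        map_one := hf.1 <| by rw [MVMHom.map_one, hr] }
    hom_inv_id := MVMHom.ext (funext hl)
    inv_hom_id := MVMHom.ext (funext hr) }

theorem isULM_goodSeq (A : MVM.{u}) : @IsULM (GoodSeq A) (goodSeqOps (goodClosed A)) :=
  inferInstanceAs (IsULM (GoodSeq A))

/-- The unit of the equivalence, `x ↦ (n ↦ ((x - n) ∨ 0) ∧ 1)`. -/
noncomputable def truncIso :
    𝟭 ULM.{u} ≅ Gamma ⋙ Xi (fun A => goodClosed A) isULM_goodSeq :=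
  NatIso.ofComponents
    (fun M => ULMHom.iso (N := (Gamma ⋙ Xi (fun A => goodClosed A) isULM_goodSeq).obj M)
      (truncHom M) truncSeq_bijective)
    fun {M N} f => ULMHom.ext <| funext fun (x : M) => GoodSeq.ext' fun k => UnitInterval.ext <| by
      change ((ULMHom.toFun f x + intConst N (-k)) ⊔ 0) ⊓ 1 =
        ULMHom.toFun f (((x + intConst M (-k)) ⊔ 0) ⊓ 1)
      rw [ULMHom.map_inf, ULMHom.map_sup, ULMHom.map_add, map_intConst, ULMHom.map_zero,
        ULMHom.map_one]

/-- The counit of the equivalence, the evaluation at `0`. -/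
noncomputable def evalIso :
    Xi (fun A => goodClosed A) isULM_goodSeq ⋙ Gamma ≅ 𝟭 MVM.{u} :=
  NatIso.ofComponents
    (fun A => MVMHom.iso (A := (Xi (fun A => goodClosed A) isULM_goodSeq ⋙ Gamma).obj A)
      (B := A) (evalHom A) evalHom_bijective)
    fun _ => rfl

end Isomorphisms

end MVMonoidal

theorem mainTheorem6 :
    ∃ (hc : ∀ A : MVMonoidal.MVM.{u}, MVMonoidal.GoodClosed A)
      (hΞ : ∀ A : MVMonoidal.MVM.{u},
        @MVMonoidal.IsULM (MVMonoidal.GoodSeq A) (MVMonoidal.goodSeqOps (hc A)))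
      (E : MVMonoidal.ULM.{u} ≌ MVMonoidal.MVM.{u}),
      E.functor = MVMonoidal.Gamma ∧ E.inverse = MVMonoidal.Xi hc hΞ :=
  ⟨fun A => MVMonoidal.goodClosed A, MVMonoidal.isULM_goodSeq,
    -- `Equivalence.mk` corrects the unit to satisfy the triangle identity and leaves both functors
    -- untouched, hence `rfl`.
    CategoryTheory.Equivalence.mk _ _ MVMonoidal.truncIso MVMonoidal.evalIso, rfl, rfl⟩
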